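/- Let $A$ be a finite-dimensional Euclidean Jordan algebra, i.e. a finite-dimensional real algebra whose product $\circ$ is bilinear and commutative, satisfies the Jordan identity $(x\circ y)\circ(x\circ x)=x\circ(y\circ(x\circ x))$, and is formally real: $\sum_{i=1}^n x_i\circ x_i=0$ implies $x_i=0$ for all $i$. An element is called positive if it is a sum of squares; the positive elements form the cone $A_+$. A primitive idempotent is an idempotent $e\neq 0$ that is not a sum $a+b$ of two nonzero idempotents with $a\circ b=0$; a spectral decomposition of $x$ is a representation $x=\sum_{i=1}^n\lambda_i e_i$ with $\lambda_i\in\mathbb{R}$ and primitive idempotents $e_i$ such that $e_i\circ e_j=0$ for $i\neq j$. Put $\mathrm{Tr}(x)=\sum_i\lambda_i$, let the state space be $C=\{x\in A_+ : \mathrm{Tr}(x)=1\}$, and call its extreme points pure states. The entropy of $x\in A_+$ is $$H(x)=\inf\Bigl(-\sum_{i=1}^n\lambda_i\ln\lambda_i\Bigr)\qquad(0\ln 0=0),$$ where the infimum is over all representations $x=\sum_{i=1}^n\lambda_i s_i$ with $n\ge 0$, $\lambda_i\geq 0$ and pure states $s_i$ (not necessarily orthogonal). Then: (1) every $x\in A$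 has a spectral decomposition, and $\mathrm{Tr}(x)$ does not depend on its choice; (2) for every $x\in A_+$ the infimum defining $H(x)$ is attained, and for every spectral decomposition $x=\sum_i\lambda_i e_i$ one has $\lambda_i\ge 0$ for all $i$ and $H(x)=-\sum_i\lambda_i\ln\lambda_i=-\mathrm{Tr}(x\ln x)$; (3) $H$ is strictly concave on the convex cone $A_+$: for $x,y\in A_+$ with $x\neq y$ and $0<t<1$, $H((1-t)x+ty)>(1-t)H(x)+tH(y)$. -/

import Mathlib

namespace EuclideanJordan

/-- A primitive idempotent: a nonzero idempotent that is not the sum of two nonzero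
orthogonal idempotents. -/
structure IsPrimitiveIdempotent {A : Type*} [NonUnitalNonAssocCommRing A] (e : A) : Prop where
  idem : e * e = e
  ne_zero : e ≠ 0
  indecomposable : ∀ a b : A, a * a = a → b * b = b → a * b = 0 → e = a + b → a = 0 ∨ b = 0

/-- `x = ∑ i, lam i • e i` with pairwise orthogonal primitive idempotents `e i`; the `lam i` are
the eigenvalues of `x`, counted with multiplicity. The system `e` need not be complete, so that
some (or all) zero eigenvalues may be left out. -/
structure IsSpectralDecomposition {A : Type*} [NonUnitalNonAssocCommRing A] [Module ℝ A]
    {n : ℕ} (x : A) (lam : Fin n → ℝ) (e : Fin n → A) : Prop where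
  primitive : ∀ i, IsPrimitiveIdempotent (e i)
  orthogonal : ∀ i j, i ≠ j → e i * e j = 0
  sum_eq : x = ∑ i, lam i • e i

open Classical in
/-- The trace of `x`: the sum of its eigenvalues, counted with multiplicity, as read off from any
spectral decomposition of `x`. -/
noncomputable def trace {A : Type*} [NonUnitalNonAssocCommRing A] [Module ℝ A] (x : A) : ℝ :=
  if h : ∃ (n : ℕ) (lam : Fin n → ℝ) (e : Fin n → A), IsSpectralDecomposition x lam e then
    ∑ i, h.choose_spec.choose i
  else 0

/-- The cone of positive elements: `0 ≤ x` means that `x` is a sum of squares. -/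
def positiveCone (A : Type*) [NonUnitalNonAssocCommRing A] : Set A :=
  {x | IsSumSq x}

/-- The state space: the density operators, i.e. the positive elements of trace one. -/
def states (A : Type*) [NonUnitalNonAssocCommRing A] [Module ℝ A] : Set A :=
  {x | x ∈ positiveCone A ∧ trace x = 1}

/-- The pure states: the extreme points of the state space. -/
def pureStates (A : Type*) [NonUnitalNonAssocCommRing A] [Module ℝ A] : Set A :=
  (states A).extremePoints ℝ

/-- The values `-∑ i, lam i * log (lam i)` (with `0 * log 0 = 0`), where `lam` runs through the
spectra of all decompositions `x = ∑ i, lam i • s i` of `x` into pure states `s i`, with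
coefficients `0 ≤ lam i`. The `s i` need not be orthogonal. -/
def decompositionEntropies {A : Type*} [NonUnitalNonAssocCommRing A] [Module ℝ A] (x : A) :
    Set ℝ :=
  {h | ∃ (n : ℕ) (lam : Fin n → ℝ) (s : Fin n → A),
    (∀ i, 0 ≤ lam i) ∧ (∀ i, s i ∈ pureStates A) ∧ x = ∑ i, lam i • s i ∧
      h = -∑ i, lam i * Real.log (lam i)}

/-- The entropy of a positive element: the infimum of `-∑ i, lam i * log (lam i)` over the spectra
of all its decompositions into pure states. -/
noncomputable def entropy {A : Type*} [NonUnitalNonAssocCommRing A] [Module ℝ A] (x : A) : ℝ :=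
  sInf (decompositionEntropies x)

end EuclideanJordan

set_option linter.unusedSectionVars false

namespace EuclideanJordan

open Polynomial

section Jordan

variable {A : Type*} [NonUnitalNonAssocCommRing A] [Module ℝ A] [SMulCommClass ℝ A A]
  [IsScalarTower ℝ A A] [IsCommJordan A]

/-! The proof rests on a linear functional τ (`normTrace`) that equals 1 on every primitive
idempotent and is associative, τ((ab)c) = τ(a(bc)). Applied to a spectral decomposition, τ gives the
sum of the eigenvalues, so the trace is well defined. The numbers τ(ef) of idempotents e, f are
nonnegative, and those of two orthogonal systems form (sub)stochastic matrices, as transition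
probabilities do in quantum mechanics.

To obtain τ, start from the trace of the multiplication operator. It is associative because
L_{(ab)c} - L_{a(bc)} is a commutator, and positive on squares by the spectral theorem, which formal
reality provides. It takes the same value on primitive idempotents with nonzero product
(`mulTrace_eq_of_mul_ne_zero`), so it can be rescaled (`exists_normTrace`).

Minimality of the spectral entropy: pure states are the primitive idempotents
(`mem_pureStates_iff`). Given x = ∑ m_j s_j with m decreasing, a Gram-Schmidt process based on the
covering property (`exists_covering`) gives orthogonal g_j, each zero or primitive, such that g_0 +
... + g_{k-1} lies above s_0, ..., s_{k-1}. The diagonal d_j = τ(g_j x) then majorizes m, so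
Karamata bounds its entropy by that of m; Jensen bounds the entropy of the eigenvalues by that of d.

Strict concavity: diagonalize the mixture z of x and y. Diagonal entropies in that frame dominate
H(x) and H(y) (`entropy_le_sum_diagonal`), and -t ln t is strictly concave, so equality forces equal
diagonals. Equality in Jensen then makes x and y diagonal in the frame
(`eq_sum_diagonal_of_le_entropy`), hence equal. -/

/-- The full linearization of the Jordan identity. -/
theorem jordan_linearized (a b c d : A) :
    a * (b * c * d) + b * (c * a * d) + c * (a * b * d) =
      b * c * (a * d) + c * a * (b * d) + a * b * (c * d) := by
  have h := DFunLike.congr_fun (two_nsmul_lie_lmul_lmul_add_add_eq_zero a b c) d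
  have h2 : (2 : ℝ) • ((a * (b * c * d) - b * c * (a * d)) + (b * (c * a * d) - c * a * (b * d))
      + (c * (a * b * d) - a * b * (c * d))) = 0 := by
    rw [two_smul, ← two_nsmul]
    exact h
  have h3 := (smul_eq_zero.mp h2).resolve_left two_ne_zero
  rw [← sub_eq_zero, ← h3]
  abel

/-! ### Peirce calculus -/

/-- Multiplication by e is a root of 2t³ - 3t² + t = t(2t - 1)(t - 1), which yields the eigenvalues
0, 1/2 and 1. -/
theorem peirce_cubic {e : A} (he : e * e = e) (a : A) :
    (2 : ℝ) • (e * (e * (e * a))) + e * a = (3 : ℝ) • (e * (e * a)) := by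
  have h := jordan_linearized e e a e
  simp only [he, mul_comm a e, mul_comm (e * a) e] at h
  linear_combination (norm := module) (1 : ℝ) • h

/-- Elements of the Peirce spaces for the eigenvalues `0` and `1` operator-commute with `e`. -/
theorem mul_left_comm_of_peirce_one {e a : A} (he : e * e = e) (ha : e * a = a) (v : A) :
    e * (a * v) = a * (e * v) := by
  have h := jordan_linearized a e e v
  simp only [he, ha, mul_comm a e] at h
  linear_combination (norm := module) (1 : ℝ) • h

theorem mul_left_comm_of_peirce_zero {e a : A} (he : e * e = e) (ha : e * a = 0) (v : A) :
    e * (a * v) = a * (e * v) := by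
  have h := jordan_linearized a e e v
  simp only [he, ha, mul_comm a e, zero_mul, mul_zero, add_zero] at h
  exact h.symm

theorem mul_eq_zero_of_peirce {e a b : A} (he : e * e = e) (ha : e * a = a) (hb : e * b = 0) :
    a * b = 0 := by
  have h1 := mul_left_comm_of_peirce_one he ha b
  have h2 := mul_left_comm_of_peirce_zero he hb a
  rw [hb, mul_zero] at h1
  rw [ha, mul_comm b a, h1] at h2
  exact h2.symm

theorem peirce_one_mul {e a b : A} (he : e * e = e) (ha : e * a = a) (hb : e * b = b) :
    e * (a * b) = a * b := by
  rw [mul_left_comm_of_peirce_one he ha, hb]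

end Jordan

/-! ### Powers of an element -/

section PowerAssociative

variable {A : Type*} [NonUnitalNonAssocCommRing A] [Module ℝ A] [SMulCommClass ℝ A A]
  [IsScalarTower ℝ A A]

/-- The element `x * q(x)`, as `q(L) x` where `L` is the multiplication by `x`. -/
noncomputable def powerEval (x : A) : ℝ[X] →ₗ[ℝ] A :=
  (LinearMap.applyₗ x) ∘ₗ (aeval (LinearMap.mulLeft ℝ x)).toLinearMap

theorem powerEval_apply (x : A) (q : ℝ[X]) :
    powerEval x q = aeval (LinearMap.mulLeft ℝ x) q x := rfl

theorem powerEval_one (x : A) : powerEval x 1 = x := by simp [powerEval_apply]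

theorem powerEval_mul (x : A) (q r : ℝ[X]) :
    powerEval x (q * r) = aeval (LinearMap.mulLeft ℝ x) q (powerEval x r) := by
  simp [powerEval_apply]

theorem powerEval_X_mul (x : A) (q : ℝ[X]) : powerEval x (X * q) = x * powerEval x q := by
  simp [powerEval_mul]

theorem powerEval_mem {x : A} {B : Submodule ℝ A} (hx : x ∈ B) (hB : ∀ v ∈ B, x * v ∈ B)
    (q : ℝ[X]) : powerEval x q ∈ B := by
  have hX (n : ℕ) : powerEval x (X ^ n) ∈ B := by
    induction n with
    | zero => simpa [powerEval_one] using hx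
    | succ n ih => rw [pow_succ', powerEval_X_mul]; exact hB _ ih
  induction q using Polynomial.induction_on' with
  | add p q hp hq => rw [map_add]; exact B.add_mem hp hq
  | monomial n a =>
    rw [← C_mul_X_pow_eq_monomial, ← smul_eq_C_mul, map_smul]
    exact B.smul_mem _ (hX n)

variable [IsCommJordan A]

/-- The induction carries two consecutive powers, because the recursion for multiplication operators
of powers has order two. -/
theorem mul_mul_powerEval_X_pow (x : A) (n : ℕ) :
    (∀ v, x * (powerEval x (X ^ n) * v) = powerEval x (X ^ n) * (x * v)) ∧
    ∀ v, x * (powerEval x (X ^ (n + 1)) * v) = powerEval x (X ^ (n + 1)) * (x * v) := by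
  have hsq (v : A) : x * (x * x * v) = x * x * (x * v) := by
    have := IsCommJordan.lmul_comm_rmul_rmul x v
    rw [mul_comm (x * v), mul_comm v] at this
    exact this.symm
  induction n with
  | zero =>
    refine ⟨fun v => by rw [pow_zero, powerEval_one], fun v => ?_⟩
    rw [zero_add, pow_one, ← mul_one X, powerEval_X_mul, powerEval_one]
    exact hsq v
  | succ n ih =>
    obtain ⟨h1, h2⟩ := ih
    refine ⟨h2, fun v => ?_⟩
    have e1 : powerEval x (X ^ (n + 1)) = x * powerEval x (X ^ n) := by
      rw [pow_succ', powerEval_X_mul]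
    have e2 : powerEval x (X ^ (n + 1 + 1)) = x * powerEval x (X ^ (n + 1)) := by
      rw [pow_succ' _ (n + 1), powerEval_X_mul]
    rw [e2]
    rw [e1] at h2 ⊢
    set p := powerEval x (X ^ n) with hp
    -- The linearized identity expresses L_{x(xp)} through L_x, L_{x²}, L_p and L_{xp}, all of which
    -- commute with L_x.
    have key (v : A) : x * (x * p) * v = (2 : ℝ) • (x * p * (x * v)) + x * x * (p * v)
        - p * (x * (x * v)) - x * (x * (p * v)) := by
      have h := jordan_linearized p x v x
      rw [mul_comm (x * v) x, mul_comm v p, mul_comm (p * v) x, mul_comm v (p * x * x),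
        mul_comm p x, mul_comm (x * p) x, mul_comm (x * v) (x * p), mul_comm (p * v) (x * x),
        mul_comm v x] at h
      linear_combination (norm := module) (1 : ℝ) • h
    simp only [key, mul_add, mul_sub, mul_smul_comm, h1, h2, hsq]

theorem mul_powerEval_mul (x : A) (q : ℝ[X]) (v : A) :
    x * (powerEval x q * v) = powerEval x q * (x * v) := by
  induction q using Polynomial.induction_on' with
  | add p q hp hq => simp only [map_add, add_mul, mul_add, hp, hq]
  | monomial n a =>
    rw [← C_mul_X_pow_eq_monomial, ← smul_eq_C_mul, map_smul]
    simp only [smul_mul_assoc, mul_smul_comm, (mul_mul_powerEval_X_pow x n).1]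

/-- Power associativity. Each factor already contains one x, hence the extra `X` on the right. -/
theorem powerEval_mul_powerEval (x : A) (q r : ℝ[X]) :
    powerEval x q * powerEval x r = powerEval x (X * (q * r)) := by
  have hX (n : ℕ) : powerEval x q * powerEval x (X ^ n) = powerEval x (X * (q * X ^ n)) := by
    induction n with
    | zero => rw [pow_zero, powerEval_one, mul_one, powerEval_X_mul, mul_comm]
    | succ n ih =>
      rw [pow_succ', powerEval_X_mul, ← mul_powerEval_mul, ih, ← powerEval_X_mul]
      congr 1; ring
  induction r using Polynomial.induction_on' with
  | add r s hr hs => simp only [map_add, mul_add, hr, hs]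
  | monomial n a =>
    rw [← C_mul_X_pow_eq_monomial, ← smul_eq_C_mul, map_smul, mul_smul_comm, hX, ← map_smul]
    simp

end PowerAssociative

/-! ### The spectral theorem -/

section Spectral

variable {A : Type*} [NonUnitalNonAssocCommRing A]

theorem eq_zero_of_mul_self_add_mul_self [IsFormallyReal A] {a b : A} (h : a * a + b * b = 0) :
    a = 0 := by
  have h0 := IsFormallyReal.eq_zero_of_add_right (IsSumSq.mul_self a) (IsSumSq.mul_self b) h
  by_contra ha
  exact IsFormallyReal.not_isSumNonzeroSq_zero (R := A) (h0 ▸ IsSumNonzeroSq.sq ha)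

variable [Module ℝ A] [SMulCommClass ℝ A A]
  [IsScalarTower ℝ A A] [IsCommJordan A] [IsFormallyReal A] [FiniteDimensional ℝ A]

theorem exists_minimal_annihilator (x : A) : ∃ m : ℝ[X], m ≠ 0 ∧ powerEval x m = 0 ∧
    ∀ r : ℝ[X], r ≠ 0 → powerEval x r = 0 → m.natDegree ≤ r.natDegree := by
  classical
  have hex : ∃ n : ℕ, ∃ m : ℝ[X], m ≠ 0 ∧ powerEval x m = 0 ∧ m.natDegree = n :=
    ⟨_, minpoly ℝ (LinearMap.mulLeft ℝ x), minpoly.ne_zero (Algebra.IsIntegral.isIntegral _),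
      by simp [powerEval_apply], rfl⟩
  obtain ⟨m, hm, h0, hd⟩ := Nat.find_spec hex
  exact ⟨m, hm, h0, fun r hr hr0 => hd ▸ Nat.find_min' hex ⟨r, hr, hr0, rfl⟩⟩

/-- The annihilator m of minimal degree has only simple, real, nonzero roots: any other root would
make the square of a nonzero element, or a sum of such squares, vanish. `S` is its set of roots. -/
theorem exists_finset_annihilator (x : A) : ∃ S : Finset ℝ, (∀ a ∈ S, a ≠ 0) ∧
    ∀ q : ℝ[X], (∀ a ∈ S, q.eval a = 0) → powerEval x q = 0 := by
  classical
  obtain ⟨m, hm, h0, hmin⟩ := exists_minimal_annihilator x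
  have hdvd {q : ℝ[X]} (h : m ∣ q) : powerEval x q = 0 := by
    obtain ⟨r, rfl⟩ := h
    rw [mul_comm, powerEval_mul, h0, map_zero]
  have hfac {d r : ℝ[X]} (h : m = d * r) (hd : 0 < d.natDegree) : powerEval x r ≠ 0 := by
    intro hr
    have hr0 : r ≠ 0 := by rintro rfl; simp at h; exact hm h
    have hd0 : d ≠ 0 := by rintro rfl; simp at hd
    have := hmin r hr0 hr
    rw [h, natDegree_mul hd0 hr0] at this
    omega
  have hsq {d r : ℝ[X]} (h : m = d * r) (hd : 0 < d.natDegree) (hq : m ∣ X * (r * r)) :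
      False := by
    refine hfac h hd (eq_zero_of_mul_self_add_mul_self (b := 0) ?_)
    rw [powerEval_mul_powerEval, hdvd hq]; simp
  have hX : ∀ a ∈ m.roots, a ≠ 0 := by
    rintro a ha rfl
    obtain ⟨r, hr⟩ := dvd_iff_isRoot.mpr (isRoot_of_mem_roots ha)
    simp only [map_zero, sub_zero] at hr
    exact hsq hr (by simp) ⟨r, by rw [hr]; ring⟩
  have hnodup : m.roots.Nodup := by
    rw [Multiset.nodup_iff_count_le_one]
    intro a
    by_contra! h
    rw [count_roots, ← Nat.succ_le_iff, le_rootMultiplicity_iff hm] at h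
    obtain ⟨r, hr⟩ := h
    exact hsq (d := X - C a) (r := (X - C a) * r) (by rw [hr]; ring) (by simp)
      ⟨X * r, by rw [hr]; ring⟩
  have hreal : ∀ z ∈ (m.map (algebraMap ℝ ℂ)).roots, z ∈ (algebraMap ℝ ℂ).range := by
    intro z hz
    have hz0 : aeval z m = 0 := by
      have := isRoot_of_mem_roots hz
      rwa [IsRoot.def, eval_map_algebraMap] at this
    by_contra hzr
    have him : z.im ≠ 0 := fun h => hzr ⟨z.re, Complex.ext rfl (by simp [h])⟩
    obtain ⟨r, hr⟩ := quadratic_dvd_of_aeval_eq_zero_im_ne_zero m hz0 him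
    set d : ℝ[X] := X ^ 2 - C (2 * z.re) * X + C (‖z‖ ^ 2) with hd
    have hd' : d = (X - C z.re) * (X - C z.re) + C z.im * C z.im := by
      rw [hd, ← Complex.normSq_eq_norm_sq, Complex.normSq_apply]
      simp only [map_mul, map_add, map_ofNat]
      ring
    have hdeg : 0 < d.natDegree := by
      have : d.natDegree = 2 := by rw [hd]; compute_degree!
      omega
    -- With d = (X - Re z)² + (Im z)² and m = d r, the two squares add up to X d r² = m X r
    -- evaluated at x, which is 0.
    have := eq_zero_of_mul_self_add_mul_self (a := powerEval x (C z.im * r))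
      (b := powerEval x ((X - C z.re) * r)) (by
        rw [powerEval_mul_powerEval, powerEval_mul_powerEval, ← map_add]
        refine hdvd ⟨X * r, ?_⟩
        rw [hr, hd']; ring)
    rw [← smul_eq_C_mul, map_smul] at this
    exact hfac hr hdeg ((smul_eq_zero.mp this).resolve_left him)
  have hsplit : m.Splits := Splits.of_splits_map (algebraMap ℝ ℂ) (IsAlgClosed.splits _) hreal
  refine ⟨m.roots.toFinset, fun a ha => hX a (Multiset.mem_toFinset.mp ha), fun q hq => ?_⟩
  by_cases hq0 : q = 0
  · simp [hq0]
  refine hdvd (hsplit.dvd_of_roots_le_roots hm ((Multiset.le_iff_subset hnodup).mpr ?_))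
  intro a ha
  exact (mem_roots hq0).mpr (hq a (Multiset.mem_toFinset.mpr ha))

/-- Spectral theorem, with (not necessarily primitive) idempotents that lie in every subspace
containing `x` and stable under multiplication by `x`. -/
theorem exists_idempotent_decomposition (x : A) : ∃ (S : Finset ℝ) (c : ℝ → A),
    (∀ a ∈ S, a ≠ 0) ∧ (∀ a ∈ S, c a * c a = c a) ∧
    (∀ a ∈ S, ∀ b ∈ S, a ≠ b → c a * c b = 0) ∧ x = ∑ a ∈ S, a • c a ∧
    ∀ B : Submodule ℝ A, x ∈ B → (∀ v ∈ B, x * v ∈ B) → ∀ a, c a ∈ B := by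
  classical
  obtain ⟨S, hS, h⟩ := exists_finset_annihilator x
  have heq {q r : ℝ[X]} (hqr : ∀ a ∈ S, q.eval a = r.eval a) : powerEval x q = powerEval x r := by
    rw [← sub_eq_zero, ← map_sub]
    exact h _ fun a ha => by rw [eval_sub, hqr a ha, sub_self]
  have hb {a b : ℝ} (ha : a ∈ S) (hb : b ∈ S) :
      (Lagrange.basis S id a).eval b = if a = b then 1 else 0 := by
    split_ifs with hab
    · subst hab
      exact Lagrange.eval_basis_self (Set.injOn_id _) ha
    · exact Lagrange.eval_basis_of_ne (v := id) hab hb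
  -- `powerEval` supplies a factor `X`, which equals a at the node a; the factor a⁻¹ cancels it.
  refine ⟨S, fun a => powerEval x (C a⁻¹ * Lagrange.basis S id a), hS, fun a ha => ?_,
    fun a ha b hb' hab => ?_, ?_, fun B hx hB a => powerEval_mem hx hB _⟩
  · rw [powerEval_mul_powerEval]
    refine heq fun b hbS => ?_
    simp only [eval_mul, eval_X, eval_C, hb ha hbS]
    split_ifs with hab
    · subst hab; field_simp [hS a ha]
    · simp
  · rw [powerEval_mul_powerEval]
    refine h _ fun d hd => ?_
    simp only [eval_mul, eval_X, eval_C, hb ha hd, hb hb' hd]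
    split_ifs with h1 h2 <;> simp_all
  · conv_lhs => rw [← powerEval_one x]
    simp only [← map_smul, ← map_sum]
    refine heq fun b hbS => ?_
    simp only [eval_finsetSum, eval_smul, eval_mul, eval_C, eval_one, smul_eq_mul]
    rw [Finset.sum_eq_single_of_mem b hbS]
    · rw [hb hbS hbS]; simp [hS b hbS]
    · intro a ha hab
      rw [hb ha hbS, if_neg hab]; simp

end Spectral

/-! ### Peirce projections of an idempotent -/

section Peirce

variable {A : Type*} [NonUnitalNonAssocCommRing A] [Module ℝ A] [SMulCommClass ℝ A A]
  [IsScalarTower ℝ A A]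

/-- For an idempotent `e`, the projection onto the Peirce space for the eigenvalue `1`. -/
noncomputable def peirceOne (e : A) : A →ₗ[ℝ] A :=
  (2 : ℝ) • (LinearMap.mulLeft ℝ e ∘ₗ LinearMap.mulLeft ℝ e) - LinearMap.mulLeft ℝ e

/-- For an idempotent `e`, the projection onto the Peirce space for the eigenvalue `1 / 2`. -/
noncomputable def peirceHalf (e : A) : A →ₗ[ℝ] A :=
  (4 : ℝ) • LinearMap.mulLeft ℝ e - (4 : ℝ) • (LinearMap.mulLeft ℝ e ∘ₗ LinearMap.mulLeft ℝ e)

/-- For an idempotent `e`, the projection onto the Peirce space for the eigenvalue `0`. -/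
noncomputable def peirceZero (e : A) : A →ₗ[ℝ] A :=
  LinearMap.id - peirceOne e - peirceHalf e

theorem peirceOne_apply (e a : A) : peirceOne e a = (2 : ℝ) • (e * (e * a)) - e * a := rfl

theorem peirceHalf_apply (e a : A) :
    peirceHalf e a = (4 : ℝ) • (e * a) - (4 : ℝ) • (e * (e * a)) := rfl

theorem peirceZero_apply (e a : A) : peirceZero e a = a - peirceOne e a - peirceHalf e a := rfl

theorem peirce_add (e a : A) : peirceOne e a + peirceHalf e a + peirceZero e a = a := by
  rw [peirceZero_apply]; abel

/-- The projections are interpolation polynomials in L_e: 2r² - r is 1 at r = 1 and vanishes at 0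
and 1/2. Likewise (1 - r)(1 - 2r), used for `peirceZero`, is 1 at 0 and vanishes at 1/2 and 1. -/
theorem peirceOne_of_mul_eq_smul {e a : A} {r : ℝ} (h : e * a = r • a) :
    peirceOne e a = (2 * r ^ 2 - r) • a := by
  rw [peirceOne_apply, h, mul_smul_comm, h]; module

theorem peirceZero_of_mul_eq_smul {e a : A} {r : ℝ} (h : e * a = r • a) :
    peirceZero e a = (1 - 3 * r + 2 * r ^ 2) • a := by
  rw [peirceZero_apply, peirceHalf_apply, peirceOne_apply, h, mul_smul_comm, h]; module

variable [IsCommJordan A]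

theorem mul_peirceOne {e : A} (he : e * e = e) (a : A) : e * peirceOne e a = peirceOne e a := by
  have h := peirce_cubic he a
  simp only [peirceOne_apply, mul_sub, mul_smul_comm]
  linear_combination (norm := module) (1 : ℝ) • h

theorem mul_peirceHalf {e : A} (he : e * e = e) (a : A) :
    e * peirceHalf e a = (2⁻¹ : ℝ) • peirceHalf e a := by
  have h := peirce_cubic he a
  simp only [peirceHalf_apply, mul_sub, mul_smul_comm]
  linear_combination (norm := module) (-2 : ℝ) • h

theorem mul_peirceZero {e : A} (he : e * e = e) (a : A) : e * peirceZero e a = 0 := by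
  rw [peirceZero_apply, mul_sub, mul_sub, mul_peirceOne he, mul_peirceHalf he, peirceOne_apply,
    peirceHalf_apply]
  module

theorem mul_eq_peirce (e a : A) :
    e * a = peirceOne e a + (2⁻¹ : ℝ) • peirceHalf e a := by
  rw [peirceOne_apply, peirceHalf_apply]; module

theorem peirceOne_eq_self {e a : A} (h : e * a = a) : peirceOne e a = a := by
  rw [peirceOne_of_mul_eq_smul (r := 1) (by rw [h, one_smul])]; module

/-- The Peirce components with respect to `e` of `peirceOne f e`, for two idempotents. -/
theorem peirce_peirceOne_idempotent {e f : A} (he : e * e = e) (hf : f * f = f) :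
    peirceOne e (peirceOne f e) = peirceOne e f * peirceOne e f ∧
    peirceZero e (peirceOne f e) = peirceZero e f - peirceZero e f * peirceZero e f := by
  set a := peirceOne e f with ha
  set b := peirceHalf e f with hb
  set c := peirceZero e f with hc
  have ha1 : e * a = a := mul_peirceOne he f
  have hb1 : e * b = (2⁻¹ : ℝ) • b := mul_peirceHalf he f
  have hc1 : e * c = 0 := mul_peirceZero he f
  have hfe : f = a + b + c := (peirce_add e f).symm
  have hef : f * e = a + (2⁻¹ : ℝ) • b := by rw [mul_comm, mul_eq_peirce]
  have hac : a * c = 0 := mul_eq_zero_of_peirce he ha1 hc1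
  have hab : e * (a * b) = (2⁻¹ : ℝ) • (a * b) := by
    rw [mul_left_comm_of_peirce_one he ha1, hb1, mul_smul_comm]
  have hcb : e * (c * b) = (2⁻¹ : ℝ) • (c * b) := by
    rw [mul_left_comm_of_peirce_zero he hc1, hb1, mul_smul_comm]
  have haa : e * (a * a) = (1 : ℝ) • (a * a) := by rw [peirce_one_mul he ha1 ha1, one_smul]
  have hcc : e * (c * c) = (0 : ℝ) • (c * c) := by
    rw [mul_left_comm_of_peirce_zero he hc1, hc1, mul_zero, zero_smul]
  have hff : f = a * a + b * b + c * c + (2 : ℝ) • (a * b) + (2 : ℝ) • (c * b) := by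
    conv_lhs => rw [← hf, hfe]
    simp only [mul_add, add_mul, mul_comm b a, mul_comm b c, mul_comm c a, hac]
    module
  have hfef : peirceOne f e = (2 : ℝ) • (a * a) + b * b + (3 : ℝ) • (a * b) + c * b
      - a - (2⁻¹ : ℝ) • b := by
    rw [peirceOne_apply, hef, hfe]
    simp only [mul_add, add_mul, mul_smul_comm, mul_comm b a, mul_comm c a, hac]
    module
  -- The relations `h1` and `h0` are the components of f = f² for the eigenvalues 1 and 0; they
  -- eliminate b².
  have h1 : a = a * a + peirceOne e (b * b) := by
    have := congrArg (peirceOne e) hff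
    rw [← ha] at this
    simp only [map_add, map_smul, peirceOne_of_mul_eq_smul haa, peirceOne_of_mul_eq_smul hcc,
      peirceOne_of_mul_eq_smul hab, peirceOne_of_mul_eq_smul hcb] at this
    linear_combination (norm := module) (1 : ℝ) • this
  have h0 : c = c * c + peirceZero e (b * b) := by
    have := congrArg (peirceZero e) hff
    rw [← hc] at this
    simp only [map_add, map_smul, peirceZero_of_mul_eq_smul haa, peirceZero_of_mul_eq_smul hcc,
      peirceZero_of_mul_eq_smul hab, peirceZero_of_mul_eq_smul hcb] at this
    linear_combination (norm := module) (1 : ℝ) • this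
  have ha' : e * a = (1 : ℝ) • a := by rw [ha1, one_smul]
  constructor
  · rw [hfef]
    simp only [map_add, map_sub, map_smul, peirceOne_of_mul_eq_smul haa,
      peirceOne_of_mul_eq_smul hab, peirceOne_of_mul_eq_smul hcb, peirceOne_of_mul_eq_smul ha',
      peirceOne_of_mul_eq_smul hb1]
    linear_combination (norm := module) (-1 : ℝ) • h1
  · rw [hfef]
    simp only [map_add, map_sub, map_smul, peirceZero_of_mul_eq_smul haa,
      peirceZero_of_mul_eq_smul hab, peirceZero_of_mul_eq_smul hcb, peirceZero_of_mul_eq_smul ha',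
      peirceZero_of_mul_eq_smul hb1]
    linear_combination (norm := module) (-1 : ℝ) • h0

end Peirce

/-! ### The trace form and the unit -/

section MulTrace

variable {A : Type*} [NonUnitalNonAssocCommRing A] [Module ℝ A] [SMulCommClass ℝ A A]
  [IsScalarTower ℝ A A] [IsCommJordan A]

/-- The trace of the multiplication operator of an element. -/
noncomputable def mulTrace : A →ₗ[ℝ] ℝ := LinearMap.trace ℝ A ∘ₗ LinearMap.mul ℝ A

theorem mulTrace_apply (x : A) : mulTrace x = LinearMap.trace ℝ A (LinearMap.mulLeft ℝ x) := rfl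

/-- The difference is the double commutator [[L_c, L_a], L_b], so its trace is zero. -/
theorem mulLeft_mul_mul_sub (a b c : A) :
    LinearMap.mulLeft ℝ (a * b * c) - LinearMap.mulLeft ℝ (a * (b * c)) =
      (LinearMap.mulLeft ℝ c * LinearMap.mulLeft ℝ a - LinearMap.mulLeft ℝ a * LinearMap.mulLeft ℝ c)
        * LinearMap.mulLeft ℝ b -
      LinearMap.mulLeft ℝ b *
      (LinearMap.mulLeft ℝ c * LinearMap.mulLeft ℝ a - LinearMap.mulLeft ℝ a * LinearMap.mulLeft ℝ c)
      := by
  ext v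
  simp only [LinearMap.sub_apply, Module.End.mul_apply, LinearMap.mulLeft_apply, mul_sub]
  have h1 := jordan_linearized a b v c
  have h2 := jordan_linearized c b v a
  rw [mul_comm (b * v) c, mul_comm v a, mul_comm (a * v) c, mul_comm v (a * b * c),
    mul_comm (b * v) (a * c), mul_comm (a * v) (b * c), mul_comm v c] at h1
  rw [mul_comm (b * v) a, mul_comm v c, mul_comm (c * v) a, mul_comm v (c * b * a),
    mul_comm (b * v) (c * a), mul_comm (c * v) (b * a), mul_comm v a, mul_comm c b,
    mul_comm c a, mul_comm b a, mul_comm (b * c) a] at h2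
  linear_combination (norm := module) (1 : ℝ) • h1 - (1 : ℝ) • h2

theorem mulTrace_mul_assoc (a b c : A) : mulTrace (a * b * c) = mulTrace (a * (b * c)) := by
  rw [← sub_eq_zero, mulTrace_apply, mulTrace_apply, ← map_sub, mulLeft_mul_mul_sub, map_sub,
    LinearMap.trace_mul_comm, sub_self]

variable [FiniteDimensional ℝ A]

theorem trace_nonneg_of_isIdempotentElem {V : Type*} [AddCommGroup V] [Module ℝ V]
    [FiniteDimensional ℝ V] {f : V →ₗ[ℝ] V} (hf : IsIdempotentElem f) :
    0 ≤ LinearMap.trace ℝ V f := by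
  rw [(LinearMap.IsIdempotentElem.isProj_range f hf).trace]
  positivity

/-- L_e is one projection plus half of another. Traces of projections are ranks, and the first
projection fixes e ≠ 0. -/
theorem mulTrace_idempotent_pos {e : A} (he : e * e = e) (h0 : e ≠ 0) : 0 < mulTrace e := by
  have h1 : IsIdempotentElem (peirceOne e) := by
    ext v
    exact peirceOne_eq_self (mul_peirceOne he v)
  have h2 : IsIdempotentElem (peirceHalf e) := by
    ext v
    rw [Module.End.mul_apply, peirceHalf_apply, mul_peirceHalf he, mul_smul_comm,
      mul_peirceHalf he]
    module
  have hL : LinearMap.mulLeft ℝ e = peirceOne e + (2⁻¹ : ℝ) • peirceHalf e := by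
    ext v
    exact mul_eq_peirce e v
  have hne : LinearMap.trace ℝ A (peirceOne e) ≠ 0 := by
    intro h
    have h3 := LinearMap.IsIdempotentElem.eq_zero_of_trace_eq_zero h1 h
    apply h0
    rw [← peirceOne_eq_self he, h3, LinearMap.zero_apply]
  have hp := trace_nonneg_of_isIdempotentElem h1
  have hh := trace_nonneg_of_isIdempotentElem h2
  rw [mulTrace_apply, hL, map_add, map_smul, smul_eq_mul]
  have := lt_of_le_of_ne hp hne.symm
  positivity

variable [IsFormallyReal A]

/-- By the spectral theorem x² is a combination of idempotents with positive coefficients. `T` is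
left general to serve both `mulTrace` and `normTrace`. -/
theorem map_mul_self_pos {T : A →ₗ[ℝ] ℝ} (hT : ∀ e : A, e * e = e → e ≠ 0 → 0 < T e) {x : A}
    (hx0 : x ≠ 0) : 0 < T (x * x) := by
  classical
  obtain ⟨S, c, hS, hc, horth, hx, -⟩ := exists_idempotent_decomposition x
  have hxx : x * x = ∑ a ∈ S, (a * a) • c a := by
    conv_lhs => rw [hx]
    rw [Finset.sum_mul_sum]
    refine Finset.sum_congr rfl fun a ha => ?_
    rw [Finset.sum_eq_single_of_mem a ha, smul_mul_smul_comm, hc a ha]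
    intro b hb hab
    rw [smul_mul_smul_comm, horth a ha b hb hab.symm, smul_zero]
  obtain ⟨a, ha, hca⟩ : ∃ a ∈ S, c a ≠ 0 := by
    by_contra! h
    exact hx0 (hx.trans (Finset.sum_eq_zero fun a ha => by rw [h a ha, smul_zero]))
  rw [hxx, map_sum]
  refine Finset.sum_pos' (fun b hb => ?_) ⟨a, ha, ?_⟩
  · rw [map_smul, smul_eq_mul]
    refine mul_nonneg (mul_self_nonneg b) ?_
    by_cases h : c b = 0
    · simp [h]
    · exact (hT _ (hc b hb) h).le
  · rw [map_smul, smul_eq_mul]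
    exact mul_pos (mul_self_pos.mpr (hS a ha)) (hT _ (hc a ha) hca)

theorem map_mul_self_nonneg {T : A →ₗ[ℝ] ℝ} (hT : ∀ e : A, e * e = e → e ≠ 0 → 0 < T e)
    (x : A) : 0 ≤ T (x * x) := by
  by_cases h : x = 0
  · simp [h]
  · exact (map_mul_self_pos hT h).le

theorem map_peirceZero_mul_peirceHalf {T : A →ₗ[ℝ] ℝ}
    (hT : ∀ a b c, T (a * b * c) = T (a * (b * c))) {e : A} (he : e * e = e) (a : A) :
    T (peirceZero e a * peirceHalf e a) = 0 := by
  have := hT (peirceZero e a) e (peirceHalf e a)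
  rw [mul_comm _ e, mul_peirceZero he, mul_peirceHalf he, mul_smul_comm, map_smul, zero_mul,
    map_zero, smul_eq_mul] at this
  linarith

theorem map_peirceHalf {T : A →ₗ[ℝ] ℝ} (hT : ∀ a b c, T (a * b * c) = T (a * (b * c))) {e : A}
    (he : e * e = e) (a : A) : T (peirceHalf e a) = 0 := by
  have := hT e e (peirceHalf e a)
  simp only [he, mul_peirceHalf he, mul_smul_comm, map_smul, smul_eq_mul] at this
  linarith

theorem map_mul_peirceOne {T : A →ₗ[ℝ] ℝ} (hT : ∀ a b c, T (a * b * c) = T (a * (b * c)))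
    {e : A} (he : e * e = e) (a : A) : T (e * peirceOne e a) = T (e * a) := by
  rw [peirceOne_apply]
  simp only [mul_sub, mul_smul_comm, map_sub, map_smul, ← hT, he, smul_eq_mul]
  ring

/-- Associativity makes the Peirce components orthogonal for `T`, and L_e acts on them by 1, 1/2 and
0. Hence `T (e * (a * a))` is nonnegative, and zero only if e a = 0. -/
theorem map_idempotent_mul_mul_self {T : A →ₗ[ℝ] ℝ} (hT : ∀ a b c, T (a * b * c) = T (a * (b * c)))
    {e : A} (he : e * e = e) (a : A) : T (e * (a * a)) =
      T (peirceOne e a * peirceOne e a) + 2⁻¹ * T (peirceHalf e a * peirceHalf e a) := by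
  have h1 : T (peirceOne e a * peirceHalf e a) = 0 := by
    have := hT (peirceOne e a) e (peirceHalf e a)
    rw [mul_comm _ e, mul_peirceOne he, mul_peirceHalf he, mul_smul_comm, map_smul,
      smul_eq_mul] at this
    linarith
  have h2 := map_peirceZero_mul_peirceHalf hT he a
  have h3 : peirceZero e a * peirceOne e a = 0 := by
    rw [mul_comm]
    exact mul_eq_zero_of_peirce he (mul_peirceOne he a) (mul_peirceZero he a)
  have h4 : T (e * (a * a)) = T (a * (e * a)) := by rw [← hT, mul_comm]
  have h5 : a * (e * a) = (peirceOne e a + peirceHalf e a + peirceZero e a) *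
      (peirceOne e a + (2⁻¹ : ℝ) • peirceHalf e a) := by rw [peirce_add, ← mul_eq_peirce]
  rw [h4, h5]
  simp only [add_mul, mul_add, mul_smul_comm, map_add, map_smul, smul_eq_mul, h2, h3,
    mul_comm (peirceHalf e a) (peirceOne e a), h1, map_zero]
  ring

theorem map_idempotent_mul_mul_self_nonneg {T : A →ₗ[ℝ] ℝ}
    (hT : ∀ a b c, T (a * b * c) = T (a * (b * c)))
    (hpos : ∀ e : A, e * e = e → e ≠ 0 → 0 < T e) {e : A} (he : e * e = e) (a : A) :
    0 ≤ T (e * (a * a)) := by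
  rw [map_idempotent_mul_mul_self hT he]
  have h1 := map_mul_self_nonneg hpos (peirceOne e a)
  have h2 := map_mul_self_nonneg hpos (peirceHalf e a)
  positivity

theorem mul_eq_zero_of_map_idempotent_mul_mul_self {T : A →ₗ[ℝ] ℝ}
    (hT : ∀ a b c, T (a * b * c) = T (a * (b * c)))
    (hpos : ∀ e : A, e * e = e → e ≠ 0 → 0 < T e) {e : A} (he : e * e = e) {a : A}
    (h : T (e * (a * a)) = 0) : e * a = 0 := by
  rw [map_idempotent_mul_mul_self hT he] at h
  have h1 := map_mul_self_nonneg hpos (peirceOne e a)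
  have h2 := map_mul_self_nonneg hpos (peirceHalf e a)
  have h3 : peirceOne e a = 0 := by
    by_contra hne
    have := map_mul_self_pos hpos hne
    linarith
  have h4 : peirceHalf e a = 0 := by
    by_contra hne
    have := map_mul_self_pos hpos hne
    linarith
  rw [mul_eq_peirce, h3, h4, smul_zero, add_zero]

theorem eq_of_forall_mulTrace_mul {x y : A} (h : ∀ z, mulTrace (x * z) = mulTrace (y * z)) :
    x = y := by
  by_contra hxy
  refine (map_mul_self_pos (fun _ => mulTrace_idempotent_pos) (sub_ne_zero.mpr hxy)).ne' ?_
  rw [sub_mul, map_sub, h, sub_self]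

/-- A formally real finite-dimensional Jordan algebra has a unit. -/
theorem exists_unit : ∃ u : A, ∀ x, u * x = x := by
  let B : A →ₗ[ℝ] Module.Dual ℝ A := LinearMap.mk₂ ℝ (fun x y => mulTrace (x * y))
    (by simp [add_mul]) (by simp [smul_mul_assoc]) (by simp [mul_add]) (by simp [mul_smul_comm])
  have hB : Function.Injective B := fun x y h =>
    eq_of_forall_mulTrace_mul fun z => DFunLike.congr_fun h z
  -- The unit is the element representing the functional `mulTrace` with respect to the
  -- nondegenerate trace form.
  obtain ⟨u, hu⟩ := (LinearMap.injective_iff_surjective_of_finrank_eq_finrank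
    (Subspace.dual_finrank_eq (K := ℝ) (V := A)).symm).mp hB mulTrace
  refine ⟨u, fun x => eq_of_forall_mulTrace_mul fun z => ?_⟩
  rw [mulTrace_mul_assoc]
  exact DFunLike.congr_fun hu (x * z)

end MulTrace

/-! ### Primitive idempotents -/

section Primitive

variable {A : Type*} [NonUnitalNonAssocCommRing A] [Module ℝ A] [SMulCommClass ℝ A A]
  [IsScalarTower ℝ A A] [IsCommJordan A] [FiniteDimensional ℝ A]

/-- Splitting a decomposable idempotent strictly lowers the dimension of the Peirce space `E` of
each part, so the splitting terminates. -/
theorem exists_primitive_finset (e : A) (he : e * e = e) : ∃ S : Finset A,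
    (∀ f ∈ S, IsPrimitiveIdempotent f) ∧ (∀ f ∈ S, ∀ g ∈ S, f ≠ g → f * g = 0) ∧
    e = ∑ f ∈ S, f := by
  classical
  let E (e : A) : Submodule ℝ A := LinearMap.ker (LinearMap.mulLeft ℝ e - LinearMap.id)
  have hE {e v : A} : v ∈ E e ↔ e * v = v := by simp [E, sub_eq_zero]
  induction h : Module.finrank ℝ (E e) using Nat.strong_induction_on generalizing e with
  | _ n ih =>
  by_cases h0 : e = 0
  · exact ⟨∅, by simp [h0]⟩
  by_cases hp : IsPrimitiveIdempotent e
  · exact ⟨{e}, by simpa using hp, by simp, by simp⟩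
  obtain ⟨a, b, ha, hb, hab, hsum, ha0, hb0⟩ : ∃ a b : A, a * a = a ∧ b * b = b ∧ a * b = 0 ∧
      e = a + b ∧ a ≠ 0 ∧ b ≠ 0 := by
    by_contra! hcon
    exact hp ⟨he, h0, fun a b ha hb hab hs => or_iff_not_imp_left.mpr
      fun h => hcon a b ha hb hab hs h⟩
  have hlt {a b : A} (ha : a * a = a) (hb : b * b = b) (hab : a * b = 0) (hs : e = a + b)
      (hb0 : b ≠ 0) : Module.finrank ℝ (E a) < Module.finrank ℝ (E e) := by
    refine Submodule.finrank_lt_finrank_of_lt (lt_of_le_of_ne (fun v hv => ?_) fun heq => ?_)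
    · rw [hE] at hv ⊢
      rw [hs, add_mul, hv, mul_comm b v, mul_eq_zero_of_peirce ha hv hab, add_zero]
    · have : b ∈ E a := heq ▸ hE.mpr (by rw [hs, add_mul, hab, hb, zero_add])
      rw [hE, hab] at this
      exact hb0 this.symm
  obtain ⟨S, hS, hSo, hSs⟩ := ih _ (h ▸ hlt ha hb hab hsum hb0) a ha rfl
  obtain ⟨T, hT, hTo, hTs⟩ := ih _ (h ▸ hlt hb ha (by rw [mul_comm, hab])
    (by rw [hsum, add_comm]) ha0) b hb rfl
  have hmem {S : Finset A} {a f : A} (hS : ∀ f ∈ S, IsPrimitiveIdempotent f)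
      (hSo : ∀ f ∈ S, ∀ g ∈ S, f ≠ g → f * g = 0) (hSs : a = ∑ f ∈ S, f) (hf : f ∈ S) :
      a * f = f := by
    rw [hSs, Finset.sum_mul, Finset.sum_eq_single_of_mem f hf, (hS f hf).idem]
    exact fun g hg hgf => hSo g hg f hf hgf
  have hST : ∀ f ∈ S, ∀ g ∈ T, f * g = 0 := by
    intro f hf g hg
    refine mul_eq_zero_of_peirce ha (hmem hS hSo hSs hf) ?_
    rw [mul_comm]
    exact mul_eq_zero_of_peirce hb (hmem hT hTo hTs hg) (by rw [mul_comm, hab])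
  have hdisj : Disjoint S T := Finset.disjoint_left.mpr fun f hf hf' =>
    (hS f hf).ne_zero ((hS f hf).idem ▸ hST f hf f hf')
  refine ⟨S ∪ T, fun f hf => ?_, fun f hf g hg hfg => ?_, ?_⟩
  · exact (Finset.mem_union.mp hf).elim (hS f) (hT f)
  · rcases Finset.mem_union.mp hf with hf | hf <;> rcases Finset.mem_union.mp hg with hg | hg
    · exact hSo f hf g hg hfg
    · exact hST f hf g hg
    · rw [mul_comm]; exact hST g hg f hf
    · exact hTo f hf g hg hfg
  · rw [Finset.sum_union hdisj, ← hSs, ← hTs, hsum]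

/-- A system of orthogonal idempotents can be refined to one of primitive idempotents. -/
theorem exists_primitive_refinement {ι : Type*} [Fintype ι] (c : ι → A)
    (hc : ∀ i, c i * c i = c i) (horth : ∀ i j, i ≠ j → c i * c j = 0) :
    ∃ (n : ℕ) (π : Fin n → ι) (f : Fin n → A), (∀ k, IsPrimitiveIdempotent (f k)) ∧
      (∀ k l, k ≠ l → f k * f l = 0) ∧
      ∀ lam : ι → ℝ, ∑ i, lam i • c i = ∑ k, lam (π k) • f k := by
  classical
  choose T hT hTo hTs using fun i => exists_primitive_finset (c i) (hc i)
  have hmem {i : ι} {f : A} (hf : f ∈ T i) : c i * f = f := by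
    rw [hTs i, Finset.sum_mul, Finset.sum_eq_single_of_mem f hf, (hT i f hf).idem]
    exact fun g hg hgf => hTo i g hg f hf hgf
  let κ := Σ i, {f // f ∈ T i}
  let σ := (Fintype.equivFin κ).symm
  refine ⟨_, fun k => (σ k).1, fun k => (σ k).2.1, fun k => hT _ _ (σ k).2.2,
    fun k l hkl => ?_, fun lam => ?_⟩
  · have hne : σ k ≠ σ l := fun h => hkl (σ.injective h)
    change ((σ k).2 : A) * (σ l).2 = 0
    generalize σ k = s at hne ⊢
    generalize σ l = t at hne ⊢
    obtain ⟨i, f, hf⟩ := s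
    obtain ⟨j, g, hg⟩ := t
    by_cases hij : i = j
    · subst hij
      exact hTo i f hf g hg (by rintro rfl; exact hne rfl)
    · refine mul_eq_zero_of_peirce (hc i) (hmem hf) ?_
      rw [mul_comm]
      exact mul_eq_zero_of_peirce (hc j) (hmem hg) (horth j i (Ne.symm hij))
  · rw [Equiv.sum_comp σ (fun s => lam s.1 • (s.2 : A)), Fintype.sum_sigma]
    refine Finset.sum_congr rfl fun i _ => ?_
    conv_lhs => rw [hTs i, Finset.smul_sum]
    exact (Finset.sum_coe_sort (T i) (fun f => lam i • f)).symm

variable [IsFormallyReal A]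

theorem exists_complete_spectralDecomposition {u : A} (hu : ∀ x, u * x = x) (x : A) :
    ∃ (n : ℕ) (lam : Fin n → ℝ) (e : Fin n → A), IsSpectralDecomposition x lam e ∧
      ∑ i, e i = u := by
  classical
  obtain ⟨S, c, -, hc, horth, hx, -⟩ := exists_idempotent_decomposition x
  set q := ∑ a ∈ S, c a with hq
  have hqc (a : ℝ) (ha : a ∈ S) : q * c a = c a := by
    rw [hq, Finset.sum_mul, Finset.sum_eq_single_of_mem a ha, hc a ha]
    exact fun b hb hba => horth b hb a ha hba
  have hqq : q * q = q := by
    conv_lhs => rw [hq, ← hq, Finset.mul_sum]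
    exact Finset.sum_congr rfl hqc
  -- The index `none` stands for u - q, which gets eigenvalue 0 and completes the system to the
  -- unit.
  obtain ⟨n, π, f, hf, hfo, hs⟩ := exists_primitive_refinement
    (fun i : Option S => i.elim (u - q) fun a => c a)
    (by
      rintro (_ | ⟨a, ha⟩)
      · simp only [Option.elim, sub_mul, mul_sub, hu, hqq, mul_comm q u]; abel
      · exact hc a ha)
    (by
      rintro (_ | ⟨a, ha⟩) (_ | ⟨b, hb⟩) hab
      · exact absurd rfl hab
      · simp [sub_mul, hu, hqc b hb]
      · simp [mul_comm (c a), sub_mul, hu, hqc a ha]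
      · exact horth a ha b hb fun h => hab (by subst h; rfl))
  refine ⟨n, fun k => (π k).elim 0 fun a => a, f, ⟨hf, hfo, ?_⟩, ?_⟩
  · rw [← hs fun i => i.elim 0 fun a => (a : ℝ)]
    simp only [Fintype.sum_option, Option.elim, zero_smul, zero_add]
    rw [hx]
    exact (Finset.sum_coe_sort S (fun a => a • c a)).symm
  · have h1 := hs fun _ => 1
    simp only [one_smul, Fintype.sum_option, Option.elim] at h1
    rw [← h1, Finset.sum_coe_sort S c, ← hq, sub_add_cancel]

theorem IsPrimitiveIdempotent.induction {p : A → Prop} (h0 : p 0)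
    (hadd : ∀ x y, p x → p y → p (x + y))
    (hsmul : ∀ (r : ℝ) e, IsPrimitiveIdempotent e → p (r • e)) (x : A) : p x := by
  obtain ⟨u, hu⟩ := exists_unit (A := A)
  obtain ⟨n, lam, e, h, -⟩ := exists_complete_spectralDecomposition hu x
  rw [h.sum_eq]
  exact Finset.sum_induction _ p hadd h0 fun i _ => hsmul _ _ (h.primitive i)

/-- The Peirce space of a primitive idempotent for the eigenvalue `1` is one-dimensional. -/
theorem IsPrimitiveIdempotent.exists_eq_smul {s a : A} (hs : IsPrimitiveIdempotent s)
    (ha : s * a = a) : ∃ t : ℝ, a = t • s := by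
  obtain ⟨S, c, -, hc, -, hx, hB⟩ := exists_idempotent_decomposition a
  have hcs (r : ℝ) : s * c r = c r := by
    have := hB (LinearMap.ker (LinearMap.mulLeft ℝ s - LinearMap.id))
      (by simpa [sub_eq_zero] using ha) (fun v hv => by
        simp only [LinearMap.mem_ker, LinearMap.sub_apply, LinearMap.mulLeft_apply,
          LinearMap.id_apply, sub_eq_zero] at hv ⊢
        exact peirce_one_mul hs.idem ha hv) r
    simpa [sub_eq_zero] using this
  have hspan : a ∈ Submodule.span ℝ {s} := by
    rw [hx]
    refine Submodule.sum_mem _ fun r hr => Submodule.smul_mem _ _ ?_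
    -- The spectral idempotents of a lie in the Peirce space of s, so each splits s and must be 0 or
    -- s.
    have := hs.indecomposable (c r) (s - c r) (hc r hr)
      (by simp only [sub_mul, mul_sub, hs.idem, hcs, hc r hr, mul_comm (c r) s]; abel)
      (by rw [mul_sub, mul_comm, hcs, hc r hr, sub_self]) (by abel)
    rcases this with h | h
    · rw [h]; exact Submodule.zero_mem _
    · rw [← sub_eq_zero.mp h]; exact Submodule.mem_span_singleton_self s
  obtain ⟨t, ht⟩ := Submodule.mem_span_singleton.mp hspan
  exact ⟨t, ht.symm⟩

/-- Let t e and t' f be the Peirce components of f along e and of e along f. Then t tr e = tr(ef) =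
t' tr f, and `peirce_peirceOne_idempotent` gives t' t = t²; t = 0 would force ef = 0. -/
theorem mulTrace_eq_of_mul_ne_zero {e f : A} (he : IsPrimitiveIdempotent e)
    (hf : IsPrimitiveIdempotent f) (hef : e * f ≠ 0) : mulTrace e = mulTrace f := by
  obtain ⟨t, ht⟩ := he.exists_eq_smul (mul_peirceOne he.idem f)
  obtain ⟨t', ht'⟩ := hf.exists_eq_smul (mul_peirceOne hf.idem e)
  have h1 : t * mulTrace e = mulTrace (e * f) := by
    rw [← map_mul_peirceOne mulTrace_mul_assoc he.idem, ht, mul_smul_comm, he.idem, map_smul, smul_eq_mul]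
  have h2 : t' * mulTrace f = mulTrace (e * f) := by
    rw [mul_comm e f, ← map_mul_peirceOne mulTrace_mul_assoc hf.idem, ht', mul_smul_comm, hf.idem, map_smul,
      smul_eq_mul]
  have h3 := (peirce_peirceOne_idempotent he.idem hf.idem).1
  rw [ht', map_smul, ht, smul_mul_smul_comm, he.idem, smul_smul] at h3
  have h4 : t' * t = t * t := smul_left_injective ℝ he.ne_zero h3
  by_cases ht0 : t = 0
  · refine absurd (mul_eq_zero_of_map_idempotent_mul_mul_self mulTrace_mul_assoc
      (fun _ => mulTrace_idempotent_pos) he.idem ?_) hef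
    rw [hf.idem, ← h1, ht0, zero_mul]
  · have h5 : t' = t := mul_right_cancel₀ ht0 h4
    rw [h5, ← h1] at h2
    exact (mul_left_cancel₀ ht0 h2).symm

end Primitive

/-! ### The normalized trace and the state space -/

section NormTrace

variable {A : Type*} [NonUnitalNonAssocCommRing A] [Module ℝ A] [SMulCommClass ℝ A A]
  [IsScalarTower ℝ A A] [IsCommJordan A] [IsFormallyReal A] [FiniteDimensional ℝ A]

/-- The element g acts on every primitive e as the scalar 1 / tr e, since only those f_i with f_i e
≠ 0 contribute and they have the same trace as e. Weighting by g normalizes `mulTrace`. -/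
theorem exists_normTrace : ∃ τ : A →ₗ[ℝ] ℝ, (∀ e, IsPrimitiveIdempotent e → τ e = 1) ∧
    ∀ a b c, τ (a * b * c) = τ (a * (b * c)) := by
  obtain ⟨u, hu⟩ := exists_unit (A := A)
  obtain ⟨n, lam, f, h, hfu⟩ := exists_complete_spectralDecomposition hu (0 : A)
  set g := ∑ i, (mulTrace (f i))⁻¹ • f i with hg
  have hge (e : A) (he : IsPrimitiveIdempotent e) : g * e = (mulTrace e)⁻¹ • e := by
    conv_rhs => arg 2; rw [← hu e, ← hfu, Finset.sum_mul]
    rw [hg, Finset.sum_mul, Finset.smul_sum]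
    refine Finset.sum_congr rfl fun i _ => ?_
    rw [smul_mul_assoc]
    by_cases hfe : f i * e = 0
    · rw [hfe, smul_zero, smul_zero]
    · rw [mulTrace_eq_of_mul_ne_zero (h.primitive i) he hfe]
  let τ : A →ₗ[ℝ] ℝ := mulTrace ∘ₗ LinearMap.mulLeft ℝ g
  have hτ (x : A) : τ x = mulTrace (g * x) := rfl
  have hτe (x e : A) (he : IsPrimitiveIdempotent e) :
      τ (x * e) = (mulTrace e)⁻¹ * mulTrace (x * e) := by
    rw [hτ, mul_comm x e, ← mulTrace_mul_assoc, hge e he, smul_mul_assoc, map_smul, smul_eq_mul]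
  refine ⟨τ, fun e he => ?_, fun a b c => ?_⟩
  · rw [← he.idem, hτe _ e he, he.idem]
    exact inv_mul_cancel₀ (mulTrace_idempotent_pos he.idem he.ne_zero).ne'
  · induction a using IsPrimitiveIdempotent.induction with
    | h0 => simp
    | hadd a a' h h' => simp only [add_mul, map_add, h, h']
    | hsmul r a ha =>
    induction c using IsPrimitiveIdempotent.induction with
    | h0 => simp
    | hadd c c' h h' => simp only [mul_add, map_add, h, h']
    | hsmul t c hc =>
    simp only [smul_mul_assoc, mul_smul_comm, map_smul, smul_eq_mul]
    congr 2
    induction b using IsPrimitiveIdempotent.induction with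
    | h0 => simp
    | hadd b b' h h' => simp only [mul_add, add_mul, map_add, h, h']
    | hsmul q b hb =>
    simp only [smul_mul_assoc, mul_smul_comm, map_smul, smul_eq_mul]
    congr 1
    -- The two sides are tr(abc) weighted by 1 / tr c and by 1 / tr a. Either ac = 0 and tr(abc) =
    -- 0, or the weights agree.
    rw [hτe _ _ hc, mul_comm a (b * c), hτe _ _ ha, mul_comm (b * c) a, ← mulTrace_mul_assoc]
    by_cases h1 : a * c = 0
    · have : mulTrace (a * b * c) = 0 := by
        rw [mul_comm a b, mulTrace_mul_assoc, h1, mul_zero, map_zero]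
      rw [this, mul_zero, mul_zero]
    · rw [mulTrace_eq_of_mul_ne_zero ha hc h1]

/-- The linear functional taking the value `1` on all primitive idempotents. -/
noncomputable def normTrace : A →ₗ[ℝ] ℝ := Classical.choose exists_normTrace

theorem IsPrimitiveIdempotent.normTrace_eq {e : A} (he : IsPrimitiveIdempotent e) :
    normTrace e = 1 :=
  (Classical.choose_spec exists_normTrace).1 e he

theorem normTrace_mul_assoc (a b c : A) : normTrace (a * b * c) = normTrace (a * (b * c)) :=
  (Classical.choose_spec exists_normTrace).2 a b c

theorem one_le_normTrace {e : A} (he : e * e = e) (h0 : e ≠ 0) : 1 ≤ normTrace e := by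
  obtain ⟨S, hS, -, hsum⟩ := exists_primitive_finset e he
  have : normTrace e = S.card := by
    rw [hsum, map_sum, Finset.sum_congr rfl fun f hf => (hS f hf).normTrace_eq]
    simp
  rw [this]
  have hne : S.Nonempty := by
    rw [Finset.nonempty_iff_ne_empty]
    rintro rfl
    exact h0 (by simpa using hsum)
  exact_mod_cast hne.card_pos

theorem normTrace_idempotent_pos (e : A) (he : e * e = e) (h0 : e ≠ 0) : 0 < normTrace e :=
  one_pos.trans_le (one_le_normTrace he h0)

theorem normTrace_mul_self_pos {x : A} (hx : x ≠ 0) : 0 < normTrace (x * x) :=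
  map_mul_self_pos normTrace_idempotent_pos hx

theorem normTrace_mul_nonneg_of_mem {e x : A} (he : e * e = e) (hx : x ∈ positiveCone A) :
    0 ≤ normTrace (e * x) := by
  change IsSumSq x at hx
  induction hx with
  | zero => simp
  | sq_add a hs ih =>
    rw [mul_add, map_add]
    exact add_nonneg (map_idempotent_mul_mul_self_nonneg normTrace_mul_assoc
      normTrace_idempotent_pos he a) ih

theorem idempotent_mem_positiveCone {e : A} (he : e * e = e) : e ∈ positiveCone A :=
  he ▸ IsSumSq.mul_self e

theorem normTrace_mul_nonneg {e f : A} (he : e * e = e) (hf : f * f = f) :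
    0 ≤ normTrace (e * f) :=
  normTrace_mul_nonneg_of_mem he (idempotent_mem_positiveCone hf)

theorem unit_sub_idem {u e : A} (hu : ∀ x, u * x = x) (he : e * e = e) :
    (u - e) * (u - e) = u - e := by
  simp only [sub_mul, mul_sub, hu, he, mul_comm e u]; abel

theorem normTrace_mul_le {e x : A} (he : e * e = e) (hx : x ∈ positiveCone A) :
    normTrace (e * x) ≤ normTrace x := by
  obtain ⟨u, hu⟩ := exists_unit (A := A)
  have := normTrace_mul_nonneg_of_mem (unit_sub_idem hu he) hx
  rw [sub_mul, hu, map_sub] at this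
  linarith

theorem IsPrimitiveIdempotent.normTrace_mul_le_one {e f : A} (hf : IsPrimitiveIdempotent f)
    (he : e * e = e) : normTrace (e * f) ≤ 1 :=
  hf.normTrace_eq ▸ normTrace_mul_le he (idempotent_mem_positiveCone hf.idem)

/-- τ((e - f)²) = 2 - 2τ(ef), and τ is positive on nonzero squares. -/
theorem IsPrimitiveIdempotent.eq_of_normTrace_mul {e f : A} (he : IsPrimitiveIdempotent e)
    (hf : IsPrimitiveIdempotent f) (h : normTrace (e * f) = 1) : e = f := by
  by_contra hne
  have := normTrace_mul_self_pos (sub_ne_zero.mpr hne)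
  simp only [sub_mul, mul_sub, map_sub, he.idem, hf.idem, mul_comm f e, h, he.normTrace_eq,
    hf.normTrace_eq] at this
  norm_num at this

theorem isPrimitiveIdempotent_of_normTrace {e : A} (he : e * e = e) (h : normTrace e = 1) :
    IsPrimitiveIdempotent e := by
  refine ⟨he, ?_, fun a b ha hb _ hs => ?_⟩
  · rintro rfl
    simp at h
  · by_contra! hcon
    have h1 := one_le_normTrace ha hcon.1
    have h2 := one_le_normTrace hb hcon.2
    rw [hs, map_add] at h
    linarith

/-! ### Eigenvalues read off by the normalized trace -/

section Decomposition

variable {n : ℕ} {x : A} {lam : Fin n → ℝ} {e : Fin n → A}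

theorem IsSpectralDecomposition.mul_apply (h : IsSpectralDecomposition x lam e) (i : Fin n) :
    x * e i = lam i • e i := by
  rw [h.sum_eq, Finset.sum_mul, Finset.sum_eq_single i, smul_mul_assoc, (h.primitive i).idem]
  · intro j _ hj
    rw [smul_mul_assoc, h.orthogonal j i hj, smul_zero]
  · simp

theorem IsSpectralDecomposition.normTrace_mul (h : IsSpectralDecomposition x lam e) (i : Fin n) :
    normTrace (e i * x) = lam i := by
  rw [mul_comm, h.mul_apply, map_smul, (h.primitive i).normTrace_eq, smul_eq_mul, mul_one]

theorem IsSpectralDecomposition.normTrace_eq (h : IsSpectralDecomposition x lam e) :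
    normTrace x = ∑ i, lam i := by
  rw [h.sum_eq, map_sum]
  exact Finset.sum_congr rfl fun i _ => by
    rw [map_smul, (h.primitive i).normTrace_eq, smul_eq_mul, mul_one]

theorem IsSpectralDecomposition.nonneg (h : IsSpectralDecomposition x lam e)
    (hx : x ∈ positiveCone A) (i : Fin n) : 0 ≤ lam i :=
  h.normTrace_mul i ▸ normTrace_mul_nonneg_of_mem (h.primitive i).idem hx

end Decomposition

theorem smul_mem_positiveCone {x : A} {r : ℝ} (hr : 0 ≤ r) (hx : x ∈ positiveCone A) :
    r • x ∈ positiveCone A := by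
  change IsSumSq x at hx
  change IsSumSq (r • x)
  induction hx with
  | zero => simp
  | sq_add a hs ih =>
    rw [smul_add]
    have : r • (a * a) = (√r • a) * (√r • a) := by
      rw [smul_mul_smul_comm, Real.mul_self_sqrt hr]
    exact this ▸ IsSumSq.sq_add _ ih

theorem trace_eq_normTrace (x : A) : trace x = normTrace x := by
  obtain ⟨u, hu⟩ := exists_unit (A := A)
  obtain ⟨n, lam, e, h, -⟩ := exists_complete_spectralDecomposition hu x
  have hex : ∃ (n : ℕ) (lam : Fin n → ℝ) (e : Fin n → A), IsSpectralDecomposition x lam e :=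
    ⟨n, lam, e, h⟩
  rw [trace, dif_pos hex]
  exact hex.choose_spec.choose_spec.choose_spec.normTrace_eq.symm

theorem mem_states_iff {x : A} : x ∈ states A ↔ x ∈ positiveCone A ∧ normTrace x = 1 := by
  rw [← trace_eq_normTrace]; rfl

theorem IsPrimitiveIdempotent.mem_states {e : A} (he : IsPrimitiveIdempotent e) : e ∈ states A :=
  mem_states_iff.mpr ⟨idempotent_mem_positiveCone he.idem, he.normTrace_eq⟩

/-- τ(ex) averages the numbers τ(e f_i) ≤ 1 over the spectrum of x; the average 1 forces f_i = e
wherever the weight is nonzero. -/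
theorem IsPrimitiveIdempotent.eq_of_mem_states {e x : A} (he : IsPrimitiveIdempotent e)
    (hx : x ∈ states A) (h : normTrace (e * x) = 1) : x = e := by
  obtain ⟨u, hu⟩ := exists_unit (A := A)
  obtain ⟨n, lam, f, hf, -⟩ := exists_complete_spectralDecomposition hu x
  rw [mem_states_iff] at hx
  have hpos := hf.nonneg hx.1
  have hsum := hf.normTrace_eq
  have hle (i : Fin n) : 0 ≤ lam i * (1 - normTrace (e * f i)) :=
    mul_nonneg (hpos i) (sub_nonneg.mpr ((hf.primitive i).normTrace_mul_le_one he.idem))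
  have h0 : ∑ i, lam i * (1 - normTrace (e * f i)) = 0 := by
    have : normTrace (e * x) = ∑ i, lam i * normTrace (e * f i) := by
      conv_lhs => rw [hf.sum_eq, Finset.mul_sum, map_sum]
      exact Finset.sum_congr rfl fun i _ => by rw [mul_smul_comm, map_smul, smul_eq_mul]
    simp only [mul_sub, mul_one, Finset.sum_sub_distrib]
    rw [← this, ← hsum, h, hx.2, sub_self]
  rw [Finset.sum_eq_zero_iff_of_nonneg fun i _ => hle i] at h0
  have hterm (i : Fin n) : lam i • f i = lam i • e := by
    rcases mul_eq_zero.mp (h0 i (Finset.mem_univ i)) with h1 | h1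
    · rw [h1, zero_smul, zero_smul]
    · rw [he.eq_of_normTrace_mul (hf.primitive i) (by linarith)]
  rw [hf.sum_eq, Finset.sum_congr rfl fun i _ => hterm i, ← Finset.sum_smul, ← hsum, hx.2,
    one_smul]

theorem convex_positiveCone : Convex ℝ (positiveCone A) := fun _ hx _ hy _ _ ha hb _ =>
  IsSumSq.add (smul_mem_positiveCone ha hx) (smul_mem_positiveCone hb hy)

theorem states_eq_convexHull : states A = convexHull ℝ {e : A | IsPrimitiveIdempotent e} := by
  refine Set.Subset.antisymm (fun x hx => ?_) (convexHull_min (fun e he => he.mem_states) ?_)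
  · obtain ⟨u, hu⟩ := exists_unit (A := A)
    obtain ⟨n, lam, f, hf, -⟩ := exists_complete_spectralDecomposition hu x
    rw [mem_states_iff] at hx
    rw [hf.sum_eq]
    exact (convex_convexHull ℝ _).sum_mem (fun i _ => hf.nonneg hx.1 i)
      (by rw [← hf.normTrace_eq, hx.2]) fun i _ => subset_convexHull ℝ _ (hf.primitive i)
  · intro x hx y hy a b ha hb hab
    rw [mem_states_iff] at hx hy ⊢
    refine ⟨convex_positiveCone hx.1 hy.1 ha hb hab, ?_⟩
    rw [map_add, map_smul, map_smul, hx.2, hy.2, smul_eq_mul, smul_eq_mul, mul_one, mul_one, hab]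

/-- The pure states are the primitive idempotents. -/
theorem mem_pureStates_iff {x : A} : x ∈ pureStates A ↔ IsPrimitiveIdempotent x := by
  constructor
  · intro hx
    rw [pureStates, states_eq_convexHull] at hx
    exact extremePoints_convexHull_subset hx
  · intro he
    -- A primitive idempotent e is even exposed: the functional τ(e ·) is at most 1 on states and
    -- equals 1 only at e.
    refine ⟨he.mem_states, fun y hy z hz ⟨a, b, ha, hb, hab, hyz⟩ => he.eq_of_mem_states hy ?_⟩
    have hle {y : A} (hy : y ∈ states A) : normTrace (x * y) ≤ 1 := by
      rw [mem_states_iff] at hy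
      exact hy.2 ▸ normTrace_mul_le he.idem hy.1
    have h1 := congrArg (fun v => normTrace (x * v)) hyz
    simp only [mul_add, mul_smul_comm, map_add, map_smul, smul_eq_mul, he.idem,
      he.normTrace_eq] at h1
    have h2 := mul_le_mul_of_nonneg_left (hle hz) hb.le
    refine le_antisymm (hle hy) (le_of_mul_le_mul_left ?_ ha)
    linarith

end NormTrace

/-! ### Inequalities for `negMulLog` -/

section RealInequalities

open Real

/-- Jensen's inequality, with the missing mass placed at 0, where `negMulLog` vanishes. -/
theorem sum_mul_negMulLog_le {κ : Type*} [Fintype κ] {w lam : κ → ℝ} (hw : ∀ k, 0 ≤ w k)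
    (hw1 : ∑ k, w k ≤ 1) (hlam : ∀ k, 0 ≤ lam k) :
    ∑ k, w k * negMulLog (lam k) ≤ negMulLog (∑ k, w k * lam k) := by
  have h := concaveOn_negMulLog.le_map_sum (t := Finset.univ)
    (w := fun i : Option κ => i.elim (1 - ∑ k, w k) w) (p := fun i => i.elim 0 lam)
    (by rintro (_ | k) _; exacts [sub_nonneg.mpr hw1, hw k]) (by simp [Fintype.sum_option])
    (by rintro (_ | k) _; exacts [le_refl (0 : ℝ), hlam k])
  simpa [Fintype.sum_option] using h

theorem sum_negMulLog_le_of_substochastic {ι κ : Type*} [Fintype ι] [Fintype κ] {lam : κ → ℝ}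
    {W : ι → κ → ℝ} (hW : ∀ i k, 0 ≤ W i k) (hrow : ∀ i, ∑ k, W i k ≤ 1)
    (hcol : ∀ k, lam k ≠ 0 → ∑ i, W i k = 1) (hlam : ∀ k, 0 ≤ lam k) :
    ∑ k, negMulLog (lam k) ≤ ∑ i, negMulLog (∑ k, W i k * lam k) := by
  calc ∑ k, negMulLog (lam k) = ∑ k, (∑ i, W i k) * negMulLog (lam k) := by
        refine Finset.sum_congr rfl fun k _ => ?_
        by_cases hk : lam k = 0
        · simp [hk]
        · rw [hcol k hk, one_mul]
    _ = ∑ i, ∑ k, W i k * negMulLog (lam k) := by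
        rw [Finset.sum_comm]
        exact Finset.sum_congr rfl fun k _ => Finset.sum_mul _ _ _
    _ ≤ _ := Finset.sum_le_sum fun i _ => sum_mul_negMulLog_le (hW i) (hrow i) hlam

theorem negMulLog_le_tangent {m d : ℝ} (hm : 0 < m) (hd : 0 ≤ d) :
    negMulLog d ≤ negMulLog m + (-log m - 1) * (d - m) := by
  rcases hd.eq_or_lt with rfl | hd
  · simp only [negMulLog]; simp; linarith
  · have h := log_le_sub_one_of_pos (div_pos hm hd)
    rw [log_div hm.ne' hd.ne'] at h
    have h1 : d * (log m - log d) ≤ m - d := by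
      calc d * (log m - log d) ≤ d * (m / d - 1) := mul_le_mul_of_nonneg_left h hd.le
        _ = m - d := by field_simp
    simp only [negMulLog]
    linarith

/-- Abel summation in inductive form; the free bound `C` lets the induction step use `c n`. -/
theorem sum_mul_le_of_partial_sums_nonneg {c a : ℕ → ℝ} {n : ℕ} {C : ℝ}
    (hc : ∀ i j, i ≤ j → j < n → c i ≤ c j) (hC : ∀ i < n, c i ≤ C)
    (ha : ∀ k ≤ n, 0 ≤ ∑ j ∈ Finset.range k, a j) :
    ∑ j ∈ Finset.range n, c j * a j ≤ C * ∑ j ∈ Finset.range n, a j := by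
  induction n generalizing C with
  | zero => simp
  | succ n ih =>
    have h := ih (C := c n) (fun i j hij hj => hc i j hij (by omega))
      (fun i hi => hc i n hi.le (by omega)) (fun k hk => ha k (by omega))
    have h2 := mul_le_mul_of_nonneg_right (hC n (by omega)) (ha (n + 1) le_rfl)
    rw [Finset.sum_range_succ] at h2 ⊢
    rw [Finset.sum_range_succ]
    linarith

/-- Karamata's inequality for the entropy function. -/
theorem sum_negMulLog_le_of_majorized {n : ℕ} {m d : ℕ → ℝ} (hm : ∀ k < n, 0 < m k)
    (hanti : ∀ i j, i ≤ j → j < n → m j ≤ m i) (hd : ∀ k < n, 0 ≤ d k)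
    (hle : ∀ k ≤ n, ∑ j ∈ Finset.range k, m j ≤ ∑ j ∈ Finset.range k, d j)
    (heq : ∑ j ∈ Finset.range n, m j = ∑ j ∈ Finset.range n, d j) :
    ∑ j ∈ Finset.range n, negMulLog (d j) ≤ ∑ j ∈ Finset.range n, negMulLog (m j) := by
  have h1 : ∑ j ∈ Finset.range n, negMulLog (d j) ≤
      ∑ j ∈ Finset.range n, (negMulLog (m j) + (-log (m j) - 1) * (d j - m j)) :=
    Finset.sum_le_sum fun j hj => negMulLog_le_tangent (hm j (Finset.mem_range.mp hj))
      (hd j (Finset.mem_range.mp hj))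
  have hmono : ∀ i j, i ≤ j → j < n → -log (m i) - 1 ≤ -log (m j) - 1 := by
    intro i j hij hj
    have := log_le_log (hm j hj) (hanti i j hij hj)
    linarith
  -- The tangent slopes increase because m decreases; d need not be sorted. The value of `C` drops
  -- out, since the differences d - m sum to zero.
  have h2 := sum_mul_le_of_partial_sums_nonneg (n := n) (c := fun j => -log (m j) - 1)
    (a := fun j => d j - m j) (C := -log (m (n - 1)) - 1) hmono
    (fun i hi => hmono i (n - 1) (by omega) (by omega))
    (fun k hk => by rw [Finset.sum_sub_distrib]; linarith [hle k hk])
  rw [Finset.sum_sub_distrib, heq, sub_self, mul_zero] at h2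
  rw [Finset.sum_add_distrib] at h1
  linarith

theorem exists_equiv_fin_antitone {ι : Type*} [Fintype ι] (m : ι → ℝ) :
    ∃ σ : Fin (Fintype.card ι) ≃ ι, Antitone (m ∘ σ) := by
  let f : Fin (Fintype.card ι) → ℝ := fun i => -m ((Fintype.equivFin ι).symm i)
  refine ⟨(Tuple.sort f).trans (Fintype.equivFin ι).symm, fun i j hij => ?_⟩
  have := Tuple.monotone_sort f hij
  simpa [f] using this

theorem sum_eq_sum_range_of_equiv {ι M : Type*} [Fintype ι] [AddCommMonoid M] {p : ι → Prop} {n : ℕ}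
    (σ : Fin n ≃ {i // p i}) (F : ι → M) (hF : ∀ i, ¬p i → F i = 0) :
    ∑ i, F i = ∑ j ∈ Finset.range n, if hj : j < n then F (σ ⟨j, hj⟩) else 0 := by
  classical
  rw [← Fin.sum_univ_eq_sum_range (fun j => if hj : j < n then F (σ ⟨j, hj⟩) else 0) n]
  simp only [Fin.is_lt, dite_true, Fin.eta]
  rw [Equiv.sum_comp σ (fun i => F i), ← Finset.sum_subtype (Finset.univ.filter p) (by simp) F]
  exact (Finset.sum_filter_of_ne fun i _ hi => by_contra fun hp => hi (hF i hp)).symm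

end RealInequalities

/-! ### Entropy -/

section Entropy

open Real

variable {A : Type*} [NonUnitalNonAssocCommRing A] [Module ℝ A] [SMulCommClass ℝ A A]
  [IsScalarTower ℝ A A] [IsCommJordan A] [IsFormallyReal A] [FiniteDimensional ℝ A]

theorem normTrace_mul_sum {ι : Type*} (t : Finset ι) (a : A) (lam : ι → ℝ) (e : ι → A) :
    normTrace (a * ∑ i ∈ t, lam i • e i) = ∑ i ∈ t, normTrace (a * e i) * lam i := by
  rw [Finset.mul_sum, map_sum]
  exact Finset.sum_congr rfl fun i _ => by rw [mul_smul_comm, map_smul, smul_eq_mul, mul_comm]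

/-! ### Orthogonalization and minimality of the spectral entropy -/

/-- Covering property: an idempotent `p` together with a primitive idempotent `s` lies under an
idempotent whose rank exceeds that of `p` by at most one. -/
theorem exists_covering {p s : A} (hp : p * p = p) (hs : IsPrimitiveIdempotent s) :
    ∃ g : A, (g = 0 ∨ IsPrimitiveIdempotent g) ∧ p * g = 0 ∧ normTrace ((p + g) * s) = 1 := by
  obtain ⟨t, ht⟩ := hs.exists_eq_smul (mul_peirceOne hs.idem p)
  have htp : normTrace (p * s) = t := by
    rw [mul_comm, ← map_mul_peirceOne normTrace_mul_assoc hs.idem, ht, mul_smul_comm, hs.idem,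
      map_smul, hs.normTrace_eq, smul_eq_mul, mul_one]
  have h0 := (peirce_peirceOne_idempotent hp hs.idem).2
  -- The new direction is the part of s orthogonal to p. It satisfies c² = (1 - t)c and τ(c) = 1 -
  -- t, so dividing by 1 - t gives an idempotent of rank one, unless t = 1 and s already lies under
  -- p.
  set c := peirceZero p s with hc
  have hpc : p * c = 0 := mul_peirceZero hp s
  have hcc : c * c = (1 - t) • c := by
    rw [ht, map_smul, ← hc] at h0
    linear_combination (norm := module) (1 : ℝ) • h0
  have hhalf : normTrace (peirceHalf p s) = 0 := map_peirceHalf normTrace_mul_assoc hp s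
  have hτc : normTrace c = 1 - t := by
    have h1 := congrArg normTrace (peirce_add p s)
    rw [map_add, map_add, hhalf, hs.normTrace_eq, ← hc] at h1
    have h2 := congrArg normTrace (mul_eq_peirce p s)
    rw [map_add, map_smul, hhalf, htp] at h2
    simp only [smul_zero, add_zero] at h1 h2
    linarith
  by_cases ht1 : t = 1
  · exact ⟨0, Or.inl rfl, mul_zero p, by rw [add_zero, htp, ht1]⟩
  have hne : 1 - t ≠ 0 := sub_ne_zero.mpr (Ne.symm ht1)
  have hcs : normTrace (c * s) = (1 - t) * (1 - t) := by
    have h1 : c * s = c * peirceOne p s + c * peirceHalf p s + c * c := by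
      rw [← mul_add, ← mul_add, hc, peirce_add]
    have h2 : c * peirceOne p s = 0 := by
      rw [mul_comm]
      exact mul_eq_zero_of_peirce hp (mul_peirceOne hp s) hpc
    rw [h1, h2, zero_add, map_add, hc, map_peirceZero_mul_peirceHalf normTrace_mul_assoc hp, ← hc,
      hcc, map_smul, hτc, zero_add, smul_eq_mul]
  refine ⟨(1 - t)⁻¹ • c, Or.inr (isPrimitiveIdempotent_of_normTrace ?_ ?_), ?_, ?_⟩
  · rw [smul_mul_smul_comm, hcc, smul_smul, mul_assoc, inv_mul_cancel₀ hne, mul_one]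
  · rw [map_smul, hτc, smul_eq_mul, inv_mul_cancel₀ hne]
  · rw [mul_smul_comm, hpc, smul_zero]
  · rw [add_mul, map_add, htp, smul_mul_assoc, map_smul, hcs, smul_eq_mul,
      inv_mul_cancel_left₀ hne]
    ring

/-- Gram-Schmidt for primitive idempotents: the condition τ(p s_j) = 1 says that s_j lies under the
partial sum p. A zero g_k records that s_k adds no rank. -/
theorem exists_orthogonalization (n : ℕ) (s : ℕ → A) (hs : ∀ k < n, IsPrimitiveIdempotent (s k)) :
    ∃ g : ℕ → A, (∀ k < n, g k = 0 ∨ IsPrimitiveIdempotent (g k)) ∧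
      ∀ k ≤ n, (∑ j ∈ Finset.range k, g j) * (∑ j ∈ Finset.range k, g j) =
          ∑ j ∈ Finset.range k, g j ∧
        ∀ j < k, normTrace ((∑ j ∈ Finset.range k, g j) * s j) = 1 := by
  induction n with
  | zero => exact ⟨0, by simp, by simp⟩
  | succ n ih =>
    obtain ⟨g, hg, hgs⟩ := ih fun k hk => hs k (by omega)
    obtain ⟨hpp, hps⟩ := hgs n le_rfl
    obtain ⟨p, hp⟩ : ∃ p, p = ∑ j ∈ Finset.range n, g j := ⟨_, rfl⟩
    rw [← hp] at hpp hps
    obtain ⟨q, hq, hpq, hqs⟩ := exists_covering hpp (hs n (by omega))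
    have hqq : q * q = q := by
      rcases hq with rfl | hq
      exacts [mul_zero 0, hq.idem]
    let g' : ℕ → A := fun k => if k < n then g k else q
    have hsum (k : ℕ) (hk : k ≤ n) : ∑ j ∈ Finset.range k, g' j = ∑ j ∈ Finset.range k, g j :=
      Finset.sum_congr rfl fun j hj => if_pos ((Finset.mem_range.mp hj).trans_le hk)
    have hsum' : ∑ j ∈ Finset.range (n + 1), g' j = p + q := by
      rw [Finset.sum_range_succ, hsum n le_rfl]
      simp [g', hp]
    have hidem : (p + q) * (p + q) = p + q := by
      simp only [add_mul, mul_add, hpp, hqq, mul_comm q p, hpq]; abel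
    refine ⟨g', fun k hk => ?_, fun k hk => ?_⟩
    · by_cases hkn : k < n
      · simpa [g', hkn] using hg k hkn
      · simpa [g', hkn] using hq
    · rcases hk.lt_or_eq with hk | rfl
      · rw [hsum k (by omega)]
        exact hgs k (by omega)
      · rw [hsum']
        refine ⟨hidem, fun j hj => ?_⟩
        rcases (Nat.lt_succ_iff.mp hj).lt_or_eq with hj' | rfl
        · refine le_antisymm ((hs j hj).normTrace_mul_le_one hidem) ?_
          rw [add_mul, map_add, hps j hj']
          linarith [normTrace_mul_nonneg hqq (hs j hj).idem]
        · exact hqs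

theorem IsSpectralDecomposition.sum_idem {n : ℕ} {x : A} {lam : Fin n → ℝ} {e : Fin n → A}
    (h : IsSpectralDecomposition x lam e) : (∑ i, e i) * (∑ i, e i) = ∑ i, e i := by
  rw [Finset.sum_mul_sum]
  refine Finset.sum_congr rfl fun i _ => ?_
  rw [Finset.sum_eq_single i, (h.primitive i).idem]
  · exact fun j _ hj => h.orthogonal i j hj.symm
  · simp

theorem IsSpectralDecomposition.sum_normTrace_mul_le {n : ℕ} {x : A} {lam : Fin n → ℝ}
    {e : Fin n → A} (h : IsSpectralDecomposition x lam e) {g : A}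
    (hg : g = 0 ∨ IsPrimitiveIdempotent g) : ∑ k, normTrace (g * e k) ≤ 1 := by
  rw [← map_sum, ← Finset.mul_sum]
  rcases hg with rfl | hg
  · simp
  · rw [mul_comm]
    exact hg.normTrace_mul_le_one h.sum_idem

/-- Both sides are compared with the diagonal d_j = τ(g_j x): d majorizes m, and d arises from the
eigenvalues by a substochastic matrix. -/
theorem sum_negMulLog_le_of_antitone {n N : ℕ} {x : A} {lam : Fin N → ℝ} {e : Fin N → A}
    (h : IsSpectralDecomposition x lam e) (hx : x ∈ positiveCone A) {m : ℕ → ℝ} {s : ℕ → A}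
    (hm : ∀ k < n, 0 < m k) (hanti : ∀ i j, i ≤ j → j < n → m j ≤ m i)
    (hs : ∀ k < n, IsPrimitiveIdempotent (s k)) (hsum : x = ∑ j ∈ Finset.range n, m j • s j) :
    ∑ k, negMulLog (lam k) ≤ ∑ j ∈ Finset.range n, negMulLog (m j) := by
  obtain ⟨g, hg, hgs⟩ := exists_orthogonalization n s hs
  have hgi (k : ℕ) (hk : k < n) : g k * g k = g k := by
    rcases hg k hk with h0 | h0
    exacts [by rw [h0, mul_zero], h0.idem]
  have hpx (k : ℕ) : normTrace ((∑ j ∈ Finset.range k, g j) * x) =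
      ∑ j ∈ Finset.range k, normTrace (g j * x) := by rw [Finset.sum_mul, map_sum]
  have hmx : normTrace x = ∑ j ∈ Finset.range n, m j := by
    rw [hsum, map_sum]
    exact Finset.sum_congr rfl fun j hj => by
      rw [map_smul, (hs j (Finset.mem_range.mp hj)).normTrace_eq, smul_eq_mul, mul_one]
  have htot : normTrace ((∑ j ∈ Finset.range n, g j) * x) = normTrace x := by
    rw [hmx, hsum, normTrace_mul_sum]
    exact Finset.sum_congr rfl fun j hj => by
      rw [(hgs n le_rfl).2 j (Finset.mem_range.mp hj), one_mul]
  have hmaj : ∑ j ∈ Finset.range n, negMulLog (normTrace (g j * x)) ≤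
      ∑ j ∈ Finset.range n, negMulLog (m j) := by
    refine sum_negMulLog_le_of_majorized hm hanti
      (fun k hk => normTrace_mul_nonneg_of_mem (hgi k hk) hx) (fun k hk => ?_) ?_
    · rw [← hpx, hsum, normTrace_mul_sum]
      calc ∑ j ∈ Finset.range k, m j
          = ∑ j ∈ Finset.range k, normTrace ((∑ j ∈ Finset.range k, g j) * s j) * m j :=
            Finset.sum_congr rfl fun j hj => by
              rw [(hgs k hk).2 j (Finset.mem_range.mp hj), one_mul]
        _ ≤ _ := Finset.sum_le_sum_of_subset_of_nonneg (Finset.range_mono hk)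
            fun j hj _ => mul_nonneg (normTrace_mul_nonneg (hgs k hk).1
              (hs j (Finset.mem_range.mp hj)).idem) (hm j (Finset.mem_range.mp hj)).le
    · rw [← hpx, htot, hmx]
  refine le_trans ?_ hmaj
  have hlam := h.nonneg hx
  -- The sum of all g_j captures the full trace of x, hence every eigenvector with nonzero
  -- eigenvalue.
  have hcol (k : Fin N) (hk : lam k ≠ 0) : ∑ j : Fin n, normTrace (g j * e k) = 1 := by
    rw [Fin.sum_univ_eq_sum_range (fun j => normTrace (g j * e k)) n, ← map_sum, ← Finset.sum_mul]
    have h1 : ∑ k, (1 - normTrace ((∑ j ∈ Finset.range n, g j) * e k)) * lam k = 0 := by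
      simp only [sub_mul, one_mul, Finset.sum_sub_distrib]
      rw [← normTrace_mul_sum, ← h.sum_eq, htot, h.normTrace_eq, sub_self]
    rw [Finset.sum_eq_zero_iff_of_nonneg fun k _ => mul_nonneg (sub_nonneg.mpr
      ((h.primitive k).normTrace_mul_le_one (hgs n le_rfl).1)) (hlam k)] at h1
    have := (mul_eq_zero.mp (h1 k (Finset.mem_univ k))).resolve_right hk
    linarith
  have := sum_negMulLog_le_of_substochastic (W := fun (j : Fin n) k => normTrace (g j * e k))
    (fun j k => normTrace_mul_nonneg (hgi j j.2) (h.primitive k).idem)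
    (fun j => h.sum_normTrace_mul_le (hg j j.2)) hcol hlam
  rw [← Fin.sum_univ_eq_sum_range (fun j => negMulLog (normTrace (g j * x))) n]
  refine this.trans_eq (Finset.sum_congr rfl fun j _ => ?_)
  rw [← normTrace_mul_sum, ← h.sum_eq]

theorem sum_negMulLog_le_of_decomposition {ι : Type*} [Fintype ι] {N : ℕ} {x : A} {lam : Fin N → ℝ}
    {e : Fin N → A} (h : IsSpectralDecomposition x lam e) (hx : x ∈ positiveCone A) {m : ι → ℝ}
    {s : ι → A} (hm : ∀ i, 0 ≤ m i) (hs : ∀ i, IsPrimitiveIdempotent (s i))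
    (hsum : x = ∑ i, m i • s i) : ∑ k, negMulLog (lam k) ≤ ∑ i, negMulLog (m i) := by
  classical
  -- Zero coefficients are dropped, because the logarithm slopes in Karamata's inequality need
  -- positive entries.
  obtain ⟨σ, hσ⟩ := exists_equiv_fin_antitone fun i : {i // m i ≠ 0} => m i
  generalize Fintype.card {i // m i ≠ 0} = n at σ hσ
  refine (sum_negMulLog_le_of_antitone (n := n) h hx
    (m := fun j => if hj : j < n then m (σ ⟨j, hj⟩) else 0)
    (s := fun j => if hj : j < n then s (σ ⟨j, hj⟩) else 0) ?_ ?_ ?_ ?_).trans_eq ?_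
  · intro k hk
    simp only [hk, dite_true]
    exact lt_of_le_of_ne (hm _) (σ ⟨k, hk⟩).2.symm
  · intro i j hij hj
    simp only [hj, hij.trans_lt hj, dite_true]
    exact hσ (show (⟨i, hij.trans_lt hj⟩ : Fin n) ≤ ⟨j, hj⟩ from hij)
  · intro k hk
    simp only [hk, dite_true]
    exact hs _
  · rw [hsum, sum_eq_sum_range_of_equiv σ (fun i => m i • s i) fun i hi => by
      rw [not_not.mp hi, zero_smul]]
    exact Finset.sum_congr rfl fun j hj => by simp only [Finset.mem_range.mp hj, dite_true]
  · rw [sum_eq_sum_range_of_equiv σ (fun i => negMulLog (m i)) fun i hi => by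
      rw [not_not.mp hi, negMulLog_zero]]
    exact Finset.sum_congr rfl fun j hj => by simp only [Finset.mem_range.mp hj, dite_true]

theorem neg_sum_mul_log {ι : Type*} [Fintype ι] (lam : ι → ℝ) :
    -∑ i, lam i * log (lam i) = ∑ i, negMulLog (lam i) := by
  simp [negMulLog, Finset.sum_neg_distrib]

theorem IsSpectralDecomposition.isLeast {n : ℕ} {x : A} {lam : Fin n → ℝ} {e : Fin n → A}
    (h : IsSpectralDecomposition x lam e) (hx : x ∈ positiveCone A) :
    IsLeast (decompositionEntropies x) (-∑ i, lam i * log (lam i)) := by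
  refine ⟨⟨n, lam, e, h.nonneg hx, fun i => mem_pureStates_iff.mpr (h.primitive i), h.sum_eq,
    rfl⟩, ?_⟩
  rintro _ ⟨N, m, s, hm, hs, hsum, rfl⟩
  rw [neg_sum_mul_log, neg_sum_mul_log]
  exact sum_negMulLog_le_of_decomposition h hx hm (fun i => mem_pureStates_iff.mp (hs i)) hsum

theorem IsSpectralDecomposition.entropy_eq {n : ℕ} {x : A} {lam : Fin n → ℝ} {e : Fin n → A}
    (h : IsSpectralDecomposition x lam e) (hx : x ∈ positiveCone A) :
    entropy x = ∑ i, negMulLog (lam i) := by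
  rw [← neg_sum_mul_log]
  exact (h.isLeast hx).csInf_eq

/-! ### Diagonals of positive elements in a complete frame -/

section Frame

variable {u : A} {n : ℕ} {z : A} {lam : Fin n → ℝ} {e : Fin n → A}

theorem entropy_le_sum_diagonal (hu : ∀ x, u * x = x) (h : IsSpectralDecomposition z lam e)
    (hfr : ∑ i, e i = u) {x : A} (hx : x ∈ positiveCone A) :
    entropy x ≤ ∑ i, negMulLog (normTrace (e i * x)) := by
  obtain ⟨N, m, f, hf, -⟩ := exists_complete_spectralDecomposition hu x
  rw [hf.entropy_eq hx]
  have := sum_negMulLog_le_of_substochastic (W := fun i k => normTrace (e i * f k))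
    (fun i k => normTrace_mul_nonneg (h.primitive i).idem (hf.primitive k).idem)
    (fun i => hf.sum_normTrace_mul_le (Or.inr (h.primitive i)))
    (fun k _ => by
      rw [← map_sum, ← Finset.sum_mul, hfr, hu, (hf.primitive k).normTrace_eq]) (hf.nonneg hx)
  refine this.trans_eq (Finset.sum_congr rfl fun i _ => ?_)
  rw [← normTrace_mul_sum, ← hf.sum_eq]

/-- Equality in Jensen forces m_k = d_i whenever τ(e_i f_k) ≠ 0. Then x and its diagonal part y
satisfy τ(x²) = τ(xy) = τ(y²), so τ((x - y)²) = 0. -/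
theorem eq_sum_diagonal_of_le_entropy (hu : ∀ x, u * x = x) (h : IsSpectralDecomposition z lam e)
    (hfr : ∑ i, e i = u) {x : A} (hx : x ∈ positiveCone A)
    (hle : ∑ i, negMulLog (normTrace (e i * x)) ≤ entropy x) :
    x = ∑ i, normTrace (e i * x) • e i := by
  obtain ⟨N, m, f, hf, hfu⟩ := exists_complete_spectralDecomposition hu x
  set d : Fin n → ℝ := fun i => normTrace (e i * x) with hd
  have hdsum (i : Fin n) : d i = ∑ k, normTrace (e i * f k) * m k := by
    rw [← normTrace_mul_sum, ← hf.sum_eq]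
  have hW (i : Fin n) (k : Fin N) : 0 ≤ normTrace (e i * f k) :=
    normTrace_mul_nonneg (h.primitive i).idem (hf.primitive k).idem
  have hrow (i : Fin n) : ∑ k, normTrace (e i * f k) = 1 := by
    rw [← map_sum, ← Finset.mul_sum, hfu, mul_comm, hu, (h.primitive i).normTrace_eq]
  have hcol (k : Fin N) : ∑ i, normTrace (e i * f k) = 1 := by
    rw [← map_sum, ← Finset.sum_mul, hfr, hu, (hf.primitive k).normTrace_eq]
  have hj (i : Fin n) : ∑ k, normTrace (e i * f k) * negMulLog (m k) ≤ negMulLog (d i) := by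
    rw [hdsum]
    exact sum_mul_negMulLog_le (hW i) (hrow i).le (hf.nonneg hx)
  have hent : entropy x = ∑ i, ∑ k, normTrace (e i * f k) * negMulLog (m k) := by
    rw [hf.entropy_eq hx, Finset.sum_comm]
    exact Finset.sum_congr rfl fun k _ => by rw [← Finset.sum_mul, hcol, one_mul]
  have hje (i : Fin n) : negMulLog (d i) = ∑ k, normTrace (e i * f k) * negMulLog (m k) :=
    ((Finset.sum_eq_sum_iff_of_le fun i _ => hj i).mp
      (le_antisymm (Finset.sum_le_sum fun i _ => hj i) (hent ▸ hle)) i (Finset.mem_univ i)).symm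
  have heq (i : Fin n) (k : Fin N) (hik : normTrace (e i * f k) ≠ 0) : m k = d i := by
    have h1 := (strictConcaveOn_negMulLog.map_sum_eq_iff_of_nonneg (t := Finset.univ)
      (w := fun k => normTrace (e i * f k)) (p := m) (fun k _ => hW i k) (hrow i)
      (fun k _ => hf.nonneg hx k)).mp (by simp only [smul_eq_mul]; rw [← hdsum, hje])
    rw [hdsum, ← mul_one (m k), ← hrow i, Finset.mul_sum]
    refine Finset.sum_congr rfl fun l _ => ?_
    by_cases hl : normTrace (e i * f l) = 0
    · simp [hl]
    · rw [h1 (Finset.mem_univ k) hik (Finset.mem_univ l) hl, mul_comm]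
  have hsq : ∑ k, m k * m k = ∑ i, d i * d i := by
    calc ∑ k, m k * m k = ∑ k, ∑ i, normTrace (e i * f k) * (m k * m k) :=
          Finset.sum_congr rfl fun k _ => by rw [← Finset.sum_mul, hcol, one_mul]
      _ = ∑ i, ∑ k, normTrace (e i * f k) * (m k * m k) := Finset.sum_comm
      _ = ∑ i, ∑ k, normTrace (e i * f k) * (d i * d i) := by
          refine Finset.sum_congr rfl fun i _ => Finset.sum_congr rfl fun k _ => ?_
          by_cases hik : normTrace (e i * f k) = 0
          · simp [hik]
          · rw [heq i k hik]
      _ = _ := Finset.sum_congr rfl fun i _ => by rw [← Finset.sum_mul, hrow, one_mul]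
  have hxx : normTrace (x * x) = ∑ k, m k * m k := by
    conv_lhs => arg 2; arg 2; rw [hf.sum_eq]
    rw [normTrace_mul_sum]
    exact Finset.sum_congr rfl fun k _ => by rw [mul_comm x, hf.normTrace_mul]
  set y := ∑ i, d i • e i with hy
  have hydec : IsSpectralDecomposition y d e := ⟨h.primitive, h.orthogonal, rfl⟩
  have hyy : normTrace (y * y) = ∑ i, d i * d i := by
    conv_lhs => arg 2; arg 2; rw [hy]
    rw [normTrace_mul_sum]
    exact Finset.sum_congr rfl fun k _ => by rw [mul_comm y, hydec.normTrace_mul]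
  have hxy : normTrace (x * y) = ∑ i, d i * d i := by
    rw [hy, normTrace_mul_sum]
    exact Finset.sum_congr rfl fun k _ => by rw [mul_comm x]
  by_contra hne
  have := normTrace_mul_self_pos (sub_ne_zero.mpr hne)
  simp only [sub_mul, mul_sub, map_sub, mul_comm y x, hxx, hyy, hxy, hsq] at this
  simp at this

end Frame

theorem strictConcaveOn_entropy : StrictConcaveOn ℝ (positiveCone A) (entropy (A := A)) := by
  refine ⟨convex_positiveCone, fun x hx y hy hxy a b ha hb hab => ?_⟩
  obtain ⟨u, hu⟩ := exists_unit (A := A)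
  have hz := convex_positiveCone hx hy ha.le hb.le hab
  obtain ⟨n, lam, e, h, hfr⟩ := exists_complete_spectralDecomposition hu (a • x + b • y)
  set ξ : Fin n → ℝ := fun i => normTrace (e i * x) with hξ
  set υ : Fin n → ℝ := fun i => normTrace (e i * y) with hυ
  have hlam (i : Fin n) : lam i = a • ξ i + b • υ i := by
    rw [← h.normTrace_mul i, mul_add, map_add, mul_smul_comm, mul_smul_comm, map_smul, map_smul]
  have hξ0 (i : Fin n) : 0 ≤ ξ i := normTrace_mul_nonneg_of_mem (h.primitive i).idem hx
  have hυ0 (i : Fin n) : 0 ≤ υ i := normTrace_mul_nonneg_of_mem (h.primitive i).idem hy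
  have hterm (i : Fin n) : a • negMulLog (ξ i) + b • negMulLog (υ i) ≤ negMulLog (lam i) := by
    rw [hlam]
    exact concaveOn_negMulLog.2 (hξ0 i) (hυ0 i) ha.le hb.le hab
  have hsum : ∑ i, (a • negMulLog (ξ i) + b • negMulLog (υ i)) =
      a • ∑ i, negMulLog (ξ i) + b • ∑ i, negMulLog (υ i) := by
    rw [Finset.sum_add_distrib, Finset.smul_sum, Finset.smul_sum]
  have hxle := entropy_le_sum_diagonal hu h hfr hx
  have hyle := entropy_le_sum_diagonal hu h hfr hy
  have hxle' := mul_le_mul_of_nonneg_left hxle ha.le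
  have hyle' := mul_le_mul_of_nonneg_left hyle hb.le
  rw [h.entropy_eq hz]
  -- Equal diagonals leave no gain from concavity, so strictness comes from x or y not being
  -- diagonal in the frame; different diagonals give a strict gain at some index.
  by_cases hd : ξ = υ
  · have hle := Finset.sum_le_sum fun i (_ : i ∈ Finset.univ) => hterm i
    rw [hsum] at hle
    simp only [smul_eq_mul] at hle ⊢
    by_contra! hcon
    refine hxy ?_
    have hx1 : ∑ i, negMulLog (ξ i) ≤ entropy x := le_of_mul_le_mul_left (by linarith) ha
    have hy1 : ∑ i, negMulLog (υ i) ≤ entropy y := le_of_mul_le_mul_left (by linarith) hb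
    rw [eq_sum_diagonal_of_le_entropy hu h hfr hx hx1,
      eq_sum_diagonal_of_le_entropy hu h hfr hy hy1]
    exact Finset.sum_congr rfl fun i _ => by rw [show normTrace (e i * x) = normTrace (e i * y)
      from congrFun hd i]
  · obtain ⟨i, hi⟩ := Function.ne_iff.mp hd
    have hlt := Finset.sum_lt_sum (fun i (_ : i ∈ Finset.univ) => hterm i)
      ⟨i, Finset.mem_univ i, by
        rw [hlam]; exact strictConcaveOn_negMulLog.2 (hξ0 i) (hυ0 i) hi ha hb hab⟩
    rw [hsum] at hlt
    simp only [smul_eq_mul] at hlt ⊢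
    linarith

end Entropy

end EuclideanJordan

theorem theorem3 {A : Type*} [NonUnitalNonAssocCommRing A] [Module ℝ A] [SMulCommClass ℝ A A]
    [IsScalarTower ℝ A A] [FiniteDimensional ℝ A] [IsCommJordan A] [IsFormallyReal A] :
    -- the trace is well defined: spectral decompositions exist and all give the same trace
    (∀ x : A, ∃ (n : ℕ) (lam : Fin n → ℝ) (e : Fin n → A),
      EuclideanJordan.IsSpectralDecomposition x lam e) ∧
    (∀ (x : A) (n : ℕ) (lam : Fin n → ℝ) (e : Fin n → A),
      EuclideanJordan.IsSpectralDecomposition x lam e →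
        EuclideanJordan.trace x = ∑ i, lam i) ∧
    -- on the positive cone the infimum defining the entropy is attained and is `-Tr (x ln x)`
    (∀ x ∈ EuclideanJordan.positiveCone A,
      IsLeast (EuclideanJordan.decompositionEntropies x) (EuclideanJordan.entropy x) ∧
      ∀ (n : ℕ) (lam : Fin n → ℝ) (e : Fin n → A),
        EuclideanJordan.IsSpectralDecomposition x lam e →
          (∀ i, 0 ≤ lam i) ∧
          EuclideanJordan.entropy x = -∑ i, lam i * Real.log (lam i)) ∧
    -- the entropy is strictly concave on the positive cone
    StrictConcaveOn ℝ (EuclideanJordan.positiveCone A) (EuclideanJordan.entropy (A := A)) := by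
  obtain ⟨u, hu⟩ := EuclideanJordan.exists_unit (A := A)
  have hex (x : A) : ∃ (n : ℕ) (lam : Fin n → ℝ) (e : Fin n → A),
      EuclideanJordan.IsSpectralDecomposition x lam e := by
    obtain ⟨n, lam, e, h, -⟩ := EuclideanJordan.exists_complete_spectralDecomposition hu x
    exact ⟨n, lam, e, h⟩
  refine ⟨hex, fun x n lam e h => ?_, fun x hx => ⟨?_, fun n lam e h => ⟨h.nonneg hx, ?_⟩⟩,
    EuclideanJordan.strictConcaveOn_entropy⟩
  · rw [EuclideanJordan.trace_eq_normTrace, h.normTrace_eq]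
  · obtain ⟨n, lam, e, h⟩ := hex x
    have := h.isLeast hx
    rwa [EuclideanJordan.entropy, this.csInf_eq]
  · rw [h.entropy_eq hx, EuclideanJordan.neg_sum_mul_log]
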